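/- Let $k\ge 0$ and let $m_1,\dots,m_k\ge 1$ be pairwise distinct integers. The spider graph $\Gamma=\mathcal O_{m_1,\dots,m_k}$ consists of a central vertex $v$ and $k$ disjoint paths $P_{m_1},\dots,P_{m_k}$ ($P_m$ having $m$ vertices), each joined to $v$ by one edge at one of its endpoints. Let $V$ and $E$ be its vertex and edge sets and $n=\sum_{j=1}^k m_j=|V|-1$. Write $X_w,Z_w$ for the Pauli operators acting on the qubit $w$. The standard dynamical Lie algebra (DLA) $\mathfrak g_{\Gamma,\mathrm{std}}$ is the real Lie algebra of operators on $(\mathbb C^2)^{\otimes V}$ generated under commutators by $i\sum_{w\in V}X_w$ and $i\sum_{ww'\in E}Z_wZ_{w'}$. The standard reduced DLA $\mathfrak g^v_{\Gamma,\mathrm{std}}$ at $v$ is the real Lie algebra of operators on $(\mathbb C^2)^{\otimes (V\setminus\{v\})}$ generated by $$i\sum_{w\ne v}X_w\qquad\text{and}\qquad i\sum_{ww'\in E,\;w,w'\neq v}Z_wZ_{w'}+i\sum_{vw\in E}Z_w ,$$ and the free reduced DLA $\mathfrak g^v_{\Gamma,\mathrm{free}}$ is generated by the individual terms $iX_w$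 ($w\ne v$), $iZ_wZ_{w'}$ ($ww'\in E$, $w,w'\ne v$) and $iZ_w$ ($vw\in E$). Then $$\mathfrak g^v_{\Gamma,\mathrm{std}}=\mathfrak g^v_{\Gamma,\mathrm{free}}\;\cong\;\bigoplus_{j=1}^k\mathfrak{so}(2m_j+1),\qquad \dim_{\mathbb R}\mathfrak g^v_{\Gamma,\mathrm{std}}=2\sum_{j=1}^k m_j^2+n\;\le\;2n^2+n,$$ where $\mathfrak{so}(N)$ is the Lie algebra of real skew-symmetric $N\times N$ matrices. By contrast, the full standard DLA grows exponentially: there are absolute constants $c>0$ and $a>1$ such that, for every $k\ge 3$ and all pairwise distinct $m_1,\dots,m_k\ge1$, $$\dim_{\mathbb R}\mathfrak g_{\mathcal O_{m_1,\dots,m_k},\mathrm{std}}\;\ge\; c\,a^{\,n}.$$ -/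

import Mathlib

open scoped DirectSum

attribute [local instance 100] LieRing.ofAssociativeRing

noncomputable section

namespace QAOA

/-- Operators on the Hilbert space `(ℂ²)^{⊗ V}` of qubits indexed by `V`, as matrices in the
computational basis `{|x⟩ : x ∈ {0,1}^V}`. -/
abbrev Op (V : Type) : Type := Matrix (V → Bool) (V → Bool) ℂ

/-- The Pauli operator `X_w`, which flips bit `w`. -/
def pauliX {V : Type} [Fintype V] [DecidableEq V] (w : V) : Op V :=
  Matrix.of fun x y => if x = Function.update y w (!(y w)) then 1 else 0

/-- The Pauli operator `Z_w`, with `Z_w |x⟩ = (-1)^{x_w} |x⟩`. -/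
def pauliZ {V : Type} [Fintype V] [DecidableEq V] (w : V) : Op V :=
  Matrix.diagonal fun x => if x w then -1 else 1

theorem pauliZ_mul_comm {V : Type} [Fintype V] [DecidableEq V] (a b : V) :
    pauliZ a * pauliZ b = pauliZ b * pauliZ a := by
  unfold pauliZ
  rw [Matrix.diagonal_mul_diagonal, Matrix.diagonal_mul_diagonal]
  congr 1
  funext x
  exact mul_comm _ _

/-- The operator `Z_w Z_w'` attached to an unordered pair `{w, w'}`. -/
def pauliZZ {V : Type} [Fintype V] [DecidableEq V] (e : Sym2 V) : Op V :=
  Sym2.lift ⟨fun a b => pauliZ a * pauliZ b, pauliZ_mul_comm⟩ e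

/-- The mixer Hamiltonian `∑_w X_w`. -/
def mixer (V : Type) [Fintype V] [DecidableEq V] : Op V := ∑ w : V, pauliX w

/-- The MaxCut problem Hamiltonian `∑_{ww' ∈ E} Z_w Z_w'`. -/
def problem {V : Type} [Fintype V] [DecidableEq V] (G : SimpleGraph V)
    [DecidableRel G.Adj] : Op V := ∑ e ∈ G.edgeFinset, pauliZZ e

/-- The standard dynamical Lie algebra of MaxCut on `G`: the real Lie algebra generated by
`i H_M` and `i H_P`. -/
def stdDLA {V : Type} [Fintype V] [DecidableEq V] (G : SimpleGraph V)
    [DecidableRel G.Adj] :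
    LieSubalgebra ℝ (Op V) :=
  LieSubalgebra.lieSpan ℝ (Op V) {Complex.I • mixer V, Complex.I • problem G}

/-- The vertices of the reduced graph. -/
abbrev Rest {V : Type} (v : V) : Type := {w : V // w ≠ v}

/-- The reduced graph: `G` with the vertex `v` removed. -/
abbrev reducedGraph {V : Type} (G : SimpleGraph V) (v : V) : SimpleGraph (Rest v) := G.comap Subtype.val

/-- The reduced problem Hamiltonian (the bit at `v` is fixed, so `Z_v` becomes `1`):
`∑_{ww' ∈ E, w, w' ≠ v} Z_w Z_w' + ∑_{vw ∈ E} Z_w`. -/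
def reducedProblem {V : Type} [Fintype V] [DecidableEq V] (G : SimpleGraph V)
    [DecidableRel G.Adj] (v : V) : Op (Rest v) :=
  (∑ e ∈ (reducedGraph G v).edgeFinset, pauliZZ e) +
    ∑ w : Rest v with G.Adj v w.val, pauliZ w

/-- The standard reduced dynamical Lie algebra of MaxCut on `G` at `v`. -/
def reducedStdDLA {V : Type} [Fintype V] [DecidableEq V] (G : SimpleGraph V)
    [DecidableRel G.Adj] (v : V) : LieSubalgebra ℝ (Op (Rest v)) :=
  LieSubalgebra.lieSpan ℝ (Op (Rest v))
    {Complex.I • mixer (Rest v), Complex.I • reducedProblem G v}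

/-- The free reduced dynamical Lie algebra of MaxCut on `G` at `v`, generated by the individual
terms of the two reduced Hamiltonians. -/
def reducedFreeDLA {V : Type} [Fintype V] [DecidableEq V] (G : SimpleGraph V)
    [DecidableRel G.Adj] (v : V) : LieSubalgebra ℝ (Op (Rest v)) :=
  LieSubalgebra.lieSpan ℝ (Op (Rest v))
    ({A | ∃ w : Rest v, A = Complex.I • pauliX w} ∪
      {A | ∃ e ∈ (reducedGraph G v).edgeSet, A = Complex.I • pauliZZ e} ∪
      {A | ∃ w : Rest v, G.Adj v w.val ∧ A = Complex.I • pauliZ w})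

/-- Vertices of the spider with `k` arms of `m 0, …, m (k-1)` vertices: the centre `none`, and the
`i`-th vertex (counted from the centre, starting at `0`) `some ⟨j, i⟩` of the `j`-th arm. -/
abbrev SpiderVertex {k : ℕ} (m : Fin k → ℕ) : Type := Option (Σ j : Fin k, Fin (m j))

/-- `b` follows immediately after `a` on the way outwards from the centre. -/
def SpiderStep {k : ℕ} (m : Fin k → ℕ) : SpiderVertex m → SpiderVertex m → Prop
  | none, some q => q.2.val = 0
  | some p, some q => p.1 = q.1 ∧ p.2.val + 1 = q.2.val
  | _, none => False

instance {k : ℕ} (m : Fin k → ℕ) : DecidableRel (SpiderStep m)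
  | none, some q => inferInstanceAs (Decidable (q.2.val = 0))
  | some p, some q => inferInstanceAs (Decidable (p.1 = q.1 ∧ p.2.val + 1 = q.2.val))
  | none, none => inferInstanceAs (Decidable False)
  | some _, none => inferInstanceAs (Decidable False)

/-- The spider graph: `k` paths with `m 0, …, m (k-1)` vertices, each joined by one of its ends
to a central vertex. -/
def spider {k : ℕ} (m : Fin k → ℕ) : SimpleGraph (SpiderVertex m) :=
  SimpleGraph.fromRel (SpiderStep m)

instance {k : ℕ} (m : Fin k → ℕ) : DecidableRel (spider m).Adj :=
  inferInstanceAs (DecidableRel (SimpleGraph.fromRel (SpiderStep m)).Adj)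

/-- The central vertex of the spider. -/
abbrev spiderCentre {k : ℕ} (m : Fin k → ℕ) : SpiderVertex m := none

end QAOA

end

/-! Along an arm the generators `i X_w` and `i Z_w Z_w'` alternate; each squares to `-1` and
anticommutes exactly with its neighbours, so that both Hamiltonians are sums of the colour classes
of a two-colouring of the frustration graph. This graph is a disjoint union of paths with `2 m_j`
vertices in the reduced case and a spider with arms of length `2 m_j` in the full case.

A Lie algebra `L` of matrices is closed, hence stable under conjugation by the exponentials of its
elements. Conjugation by `exp ((π / 2) ∑ p ∈ I, h p)`, for an independent set `I`, multiplies the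
generator `h q` by the sign of the number of neighbours of `q` in `I`. If `L` contains the sums over
the cells of a partition, it therefore contains the sums over the finer partition obtained by
separating elements with different parities. The process ends at a partition that is equitable
modulo two, and when the lengths are distinct the only such partition refining the colouring is the
discrete one: `L` contains every generator.

In the reduced case the Jordan–Wigner transformation turns the `2 m_j` generators of an arm into
`2 m_j + 1` Majorana operators, whose pairwise products span a copy of `so(2 m_j + 1)`; different
arms commute. In the full case the generator of the centre anticommutes with the innermost
generators of all arms. With at least three arms this yields commutators that flip two bits of an
`X`-string in `L` at will outside of one arm, and the number of strings so obtained is exponential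
in the number of qubits off that arm; take the shortest arm. -/

noncomputable section

namespace QAOA

section Anticommute

/-- The relation `x y = -y x`, counterpart of `Commute` for the Pauli-type operators below. -/
def Anticommute {A : Type*} [Mul A] [Neg A] (x y : A) : Prop := x * y = -(y * x)

namespace Anticommute

variable {A : Type*} [Ring A] {x y z : A}

theorem symm (h : Anticommute x y) : Anticommute y x := neg_eq_iff_eq_neg.mp (Eq.symm h)

theorem mul_left (hx : Anticommute x z) (hy : Anticommute y z) : Commute (x * y) z := by
  rw [Commute, SemiconjBy, mul_assoc, hy, mul_neg, ← mul_assoc, hx, neg_mul, neg_neg, mul_assoc]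

theorem mul_commute_left (hx : Anticommute x z) (hy : Commute y z) : Anticommute (x * y) z := by
  rw [Anticommute, mul_assoc, hy.eq, ← mul_assoc, hx, neg_mul, mul_assoc]

theorem commute_mul_left (hy : Anticommute y z) (hx : Commute x z) : Anticommute (x * y) z := by
  rw [Anticommute, mul_assoc, hy, mul_neg, ← mul_assoc, hx.eq, mul_assoc]

theorem smul_smul {R : Type*} [CommSemiring R] [Algebra R A] (h : Anticommute x y) (r s : R) :
    Anticommute (r • x) (s • y) := by
  rw [Anticommute, smul_mul_smul_comm, h, smul_neg, smul_mul_smul_comm, mul_comm]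

theorem mul_mem {K : Type*} [Field K] [CharZero K] [Algebra K A] {L : LieSubalgebra K A}
    (h : Anticommute x y) (hx : x ∈ L) (hy : y ∈ L) : x * y ∈ L := by
  have hlie : ⁅x, y⁆ = (2 : K) • (x * y) := by
    rw [LieRing.of_associative_ring_bracket, h.symm, sub_neg_eq_add, two_smul]
  have := L.smul_mem (2⁻¹ : K) (L.lie_mem hx hy)
  rwa [hlie, inv_smul_smul₀ two_ne_zero] at this

end Anticommute

end Anticommute

section Exponential

variable {A : Type*} [NormedRing A] [NormedAlgebra ℝ A]

open NormedSpace Real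

theorem exp_pi_div_two_smul {x : A} (hx : x * x = -1) : exp ((π / 2) • x) = x := by
  let _ := NormedAlgebra.restrictScalars ℚ ℝ A
  let φ : ℂ →ₐ[ℝ] A := Complex.lift ⟨x, hx⟩
  have hφ : Continuous φ := φ.toLinearMap.continuous_of_finiteDimensional
  have hI : φ Complex.I = x := by simp [φ]
  have hexp : exp ((π / 2) • Complex.I) = Complex.I := by
    rw [← Complex.exp_eq_exp_ℂ, Complex.real_smul]
    push_cast
    exact Complex.exp_pi_div_two_mul_I
  calc exp ((π / 2) • x) = φ (exp ((π / 2) • Complex.I)) := by rw [map_exp φ hφ, map_smul, hI]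
    _ = x := by rw [hexp, hI]

variable [CompleteSpace A]

theorem hasSum_exp_apply (T : A →L[ℝ] A) (y : A) :
    HasSum (fun n : ℕ => (n.factorial⁻¹ : ℝ) • (T ^ n) y) (exp T y) :=
  (exp_series_hasSum_exp' (𝕂 := ℝ) T).mapL (ContinuousLinearMap.apply ℝ A y)

theorem exp_mul_apply (x y : A) : exp (ContinuousLinearMap.mul ℝ A x) y = exp x * y := by
  have hpow (n : ℕ) : (ContinuousLinearMap.mul ℝ A x ^ n) y = x ^ n * y := by
    induction n with
    | zero => simp
    | succ n ih => rw [pow_succ', pow_succ', mul_assoc, ← ih]; rfl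
  refine (hasSum_exp_apply _ y).unique ?_
  simpa only [hpow, smul_mul_assoc] using (exp_series_hasSum_exp' (𝕂 := ℝ) x).mul_right y

theorem exp_flip_mul_apply (x y : A) :
    exp ((ContinuousLinearMap.mul ℝ A).flip x) y = y * exp x := by
  have hpow (n : ℕ) : ((ContinuousLinearMap.mul ℝ A).flip x ^ n) y = y * x ^ n := by
    induction n with
    | zero => simp
    | succ n ih => rw [pow_succ', pow_succ, ← mul_assoc, ← ih]; rfl
  refine (hasSum_exp_apply _ y).unique ?_
  simpa only [hpow, mul_smul_comm] using (exp_series_hasSum_exp' (𝕂 := ℝ) x).mul_left y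

theorem exp_mul_sub_flip_mul_apply (x y : A) :
    exp (ContinuousLinearMap.mul ℝ A x - (ContinuousLinearMap.mul ℝ A).flip x) y =
      exp x * y * exp (-x) := by
  let _ := NormedAlgebra.restrictScalars ℚ ℝ (A →L[ℝ] A)
  have hcomm : Commute (ContinuousLinearMap.mul ℝ A x) ((ContinuousLinearMap.mul ℝ A).flip (-x)) :=
    ContinuousLinearMap.ext fun z => (mul_assoc x z (-x)).symm
  rw [sub_eq_add_neg, ← map_neg, exp_add_of_commute hcomm, mul_apply_eq_comp,
    exp_flip_mul_apply, exp_mul_apply, mul_assoc]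

theorem exp_mul_mul_exp_neg_mem {L : LieSubalgebra ℝ A} (hL : IsClosed (L : Set A)) {x y : A}
    (hx : x ∈ L) (hy : y ∈ L) : exp x * y * exp (-x) ∈ L := by
  let ad := ContinuousLinearMap.mul ℝ A x - (ContinuousLinearMap.mul ℝ A).flip x
  have hpow (n : ℕ) : (ad ^ n) y ∈ L := by
    induction n with
    | zero => simpa using hy
    | succ n ih => rw [pow_succ']; exact L.lie_mem hx ih
  rw [← exp_mul_sub_flip_mul_apply]
  exact hL.mem_of_tendsto (hasSum_exp_apply ad y)
    (.of_forall fun s => sum_mem fun n _ => L.smul_mem _ (hpow n))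

end Exponential

section Frustration

open Finset

theorem zmod_two_eq_zero_or_one (d : ZMod 2) : d = 0 ∨ d = 1 := by decide +revert

open scoped Classical in
/-- The number of neighbours of `x` in `I`, modulo two. -/
def degreeParity {ι : Type*} (G : SimpleGraph ι) (I : Finset ι) (x : ι) : ZMod 2 :=
  #{y ∈ I | G.Adj x y}

open scoped Classical in
theorem degreeParity_eq_sum {ι : Type*} (G : SimpleGraph ι) (I : Finset ι) (x : ι) :
    degreeParity G I x = ∑ y ∈ I, if G.Adj x y then 1 else 0 := by
  rw [degreeParity, card_filter]; push_cast; rfl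

/-- Operators `h p` squaring to `-1` that anticommute or commute according to whether `p` and `q`
are adjacent: `G` is the frustration graph of the family. -/
structure IsFrustrationFamily {ι A : Type*} [Ring A] (G : SimpleGraph ι) (h : ι → A) : Prop where
  mul_self (p : ι) : h p * h p = -1
  anticommute {p q : ι} : G.Adj p q → Anticommute (h p) (h q)
  commute {p q : ι} : ¬G.Adj p q → Commute (h p) (h q)

open scoped Classical in
/-- The class of `z` under `s`. -/
def cell {ι : Type*} [Fintype ι] (s : Setoid ι) (z : ι) : Finset ι := {y | s z y}

@[simp]
theorem mem_cell {ι : Type*} [Fintype ι] {s : Setoid ι} {y z : ι} : y ∈ cell s z ↔ s z y := by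
  simp [cell]

/-- A partition is equitable modulo two when any two members of a cell have, modulo two, equally
many neighbours in every cell. -/
def IsEquitable {ι : Type*} [Fintype ι] (G : SimpleGraph ι) (s : Setoid ι) : Prop :=
  ∀ z ⦃x y⦄, s x y → degreeParity G (cell s z) x = degreeParity G (cell s z) y

/-- A colouring is rigid when the only equitable partition modulo two refining it is the
discrete one. -/
def IsRigid {ι α : Type*} [Fintype ι] (G : SimpleGraph ι) (c : ι → α) : Prop :=
  ∀ s ≤ Setoid.ker c, IsEquitable G s → s = ⊥

namespace IsFrustrationFamily

variable {ι A : Type*} {G : SimpleGraph ι} [NormedRing A] [NormedAlgebra ℝ A] [CompleteSpace A]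
  {L : LieSubalgebra ℝ A} {h : ι → A} {I : Finset ι}

open NormedSpace
open scoped Real

theorem exp_sum_mul (H : IsFrustrationFamily G h) (hI : G.IsIndepSet I) (q : ι) :
    exp ((π / 2) • ∑ p ∈ I, h p) * h q =
      (-1 : ℝ) ^ (degreeParity G I q).val • (h q * exp ((π / 2) • ∑ p ∈ I, h p)) := by
  classical
  let _ := NormedAlgebra.restrictScalars ℚ ℝ A
  rw [degreeParity_eq_sum]
  induction I using Finset.induction_on with
  | empty => simp
  | insert a I ha ih =>
    have hcomm : Commute ((π / 2) • h a) ((π / 2) • ∑ p ∈ I, h p) :=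
      ((Commute.sum_right _ _ _ fun p hp => H.commute (hI (by simp) (by simp [hp])
        (ne_of_mem_of_not_mem hp ha).symm)).smul_left _).smul_right _
    rw [sum_insert ha, sum_insert ha, smul_add, exp_add_of_commute hcomm,
      exp_pi_div_two_smul (H.mul_self a), mul_assoc, ih (hI.mono (by simp)), mul_smul_comm]
    have hflip (d : ZMod 2) : (-1 : ℝ) ^ (1 + d).val = -(-1) ^ d.val := by
      obtain rfl | rfl := zmod_two_eq_zero_or_one d <;>
        simp [CharTwo.add_self_eq_zero, ZMod.val_one]
    split_ifs with hadj
    · rw [hflip, neg_smul, ← smul_neg, ← mul_assoc, H.anticommute hadj.symm, neg_mul, mul_assoc]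
    · rw [zero_add, ← mul_assoc, (H.commute (mt G.adj_symm hadj)).eq, mul_assoc]

/-- Conjugation by `exp ((π / 2) ∑ p ∈ I, h p)` preserves `L` and multiplies `h q` by the sign of
the number of neighbours of `q` in `I`. -/
theorem sum_degreeParity_mem (H : IsFrustrationFamily G h) (hL : IsClosed (L : Set A))
    (hI : G.IsIndepSet I) (hIL : ∑ p ∈ I, h p ∈ L) {K : Finset ι} (hKL : ∑ q ∈ K, h q ∈ L)
    (d : ZMod 2) : ∑ q ∈ K with degreeParity G I q = d, h q ∈ L := by
  let _ := NormedAlgebra.restrictScalars ℚ ℝ A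
  set P := (π / 2) • ∑ p ∈ I, h p
  have hconj (q : ι) : exp P * h q * exp (-P) = (-1 : ℝ) ^ (degreeParity G I q).val • h q := by
    rw [H.exp_sum_mul hI, smul_mul_assoc, mul_assoc,
      ← exp_add_of_commute (Commute.refl P).neg_right, add_neg_cancel, exp_zero, mul_one]
  have hsign : ∑ q ∈ K, (-1 : ℝ) ^ (degreeParity G I q).val • h q ∈ L := by
    have := exp_mul_mul_exp_neg_mem hL (L.smul_mem (π / 2) hIL) hKL
    simpa only [mul_sum, sum_mul, ← hconj] using this
  have hproj : ∑ q ∈ K with degreeParity G I q = d, h q = (2⁻¹ : ℝ) •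
      (∑ q ∈ K, h q + (-1 : ℝ) ^ d.val • ∑ q ∈ K, (-1 : ℝ) ^ (degreeParity G I q).val • h q) := by
    rw [sum_filter, smul_sum, ← sum_add_distrib, smul_sum]
    refine sum_congr rfl fun q _ => ?_
    generalize degreeParity G I q = e
    obtain rfl | rfl := zmod_two_eq_zero_or_one d <;>
      obtain rfl | rfl := zmod_two_eq_zero_or_one e <;>
      simp [ZMod.val_one, ← two_smul ℝ (h q)]
  exact hproj ▸ L.smul_mem _ (L.add_mem hKL (L.smul_mem _ hsign))

theorem exists_isEquitable [Fintype ι] (H : IsFrustrationFamily G h)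
    (hL : IsClosed (L : Set A)) {α : Type*} [DecidableEq α] (c : G.Coloring α)
    (hc : ∀ a, ∑ q with c q = a, h q ∈ L) :
    ∃ s ≤ Setoid.ker c, IsEquitable G s ∧ ∀ x, ∑ q ∈ cell s x, h q ∈ L := by
  have hfin : Finite (Setoid ι) := Finite.of_injective (fun (s : Setoid ι) x y => s x y)
    fun _ _ hst => Setoid.ext fun x y => iff_of_eq (congrFun₂ hst x y)
  have hker (x : ι) : ∑ q ∈ cell (Setoid.ker c) x, h q ∈ L := by
    convert hc (c x) using 2
    ext q
    simp [Setoid.ker_def, eq_comm]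
  obtain ⟨s, ⟨hsc, hsL⟩, hmin⟩ := Set.Finite.exists_minimal
    (Set.toFinite {s | s ≤ Setoid.ker c ∧ ∀ x, ∑ q ∈ cell s x, h q ∈ L}) ⟨_, le_rfl, hker⟩
  refine ⟨s, hsc, fun z => ?_, hsL⟩
  have hindep : G.IsIndepSet (cell s z) := fun p hp q hq _ hpq =>
    c.valid hpq (hsc (s.trans' (s.symm' (mem_cell.1 hp)) (mem_cell.1 hq)))
  have hsplit (x : ι) :
      ∑ q ∈ cell (s ⊓ Setoid.ker (degreeParity G (cell s z))) x, h q ∈ L := by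
    convert H.sum_degreeParity_mem hL hindep (hsL z) (hsL x) (degreeParity G (cell s z) x) using 2
    ext q
    simp [cell, Setoid.inf_def, Setoid.ker_def, eq_comm]
  exact fun x y hxy => (hmin ⟨inf_le_left.trans hsc, hsplit⟩ inf_le_left hxy).2

theorem mem_of_isRigid [Fintype ι] (H : IsFrustrationFamily G h) (hL : IsClosed (L : Set A))
    {α : Type*} [DecidableEq α] (c : G.Coloring α) (hrigid : IsRigid G c)
    (hc : ∀ a, ∑ q with c q = a, h q ∈ L) (q : ι) : h q ∈ L := by
  obtain ⟨s, hsc, hs, hsL⟩ := H.exists_isEquitable hL c hc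
  obtain rfl := hrigid s hsc hs
  classical
  simpa [cell, Setoid.bot_def, sum_filter] using hsL q

end IsFrustrationFamily

end Frustration

section ZeroForcing

variable {ι : Type*} [Fintype ι] {G : SimpleGraph ι} {s : Setoid ι} {u x y : ι}

theorem cell_eq_singleton_iff : cell s x = {x} ↔ ∀ y, s x y → y = x := by
  simp only [Finset.ext_iff, mem_cell, Finset.mem_singleton]
  exact forall_congr' fun y => ⟨Iff.mp, fun h => ⟨h, fun hy => hy ▸ s.refl' x⟩⟩

theorem IsEquitable.adj_of_cell_eq_singleton (hs : IsEquitable G s) (hx : cell s x = {x})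
    (hxu : G.Adj x u) (huy : s u y) : G.Adj x y := by
  have := hs x huy
  simp only [hx, degreeParity_eq_sum, Finset.sum_singleton, if_pos hxu.symm] at this
  by_contra hxy
  simp [G.adj_comm y, hxy] at this

theorem IsEquitable.cell_eq_singleton_of_adj (hs : IsEquitable G s) (hx : cell s x = {x})
    (hxu : G.Adj x u) (hother : ∀ w, G.Adj x w → w ≠ u → cell s w = {w}) : cell s u = {u} := by
  refine cell_eq_singleton_iff.2 fun y huy => ?_
  by_contra hyu
  have hy := hother y (hs.adj_of_cell_eq_singleton hx hxu huy) hyu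
  exact hyu (cell_eq_singleton_iff.1 hy u (s.symm' huy)).symm

theorem eq_bot_of_cell_eq_singleton (h : ∀ x, cell s x = {x}) : s = ⊥ :=
  eq_bot_iff.2 fun x y hxy => (cell_eq_singleton_iff.1 (h x) y hxy).symm

end ZeroForcing

section HubGraph

open Finset

variable {J C : Type*}

/-- The vertices of a disjoint union of paths, the `j`-th of which has `N j` vertices. -/
abbrev Arm (N : J → ℕ) : Type _ := Σ j, Fin (N j)

/-- `y` follows immediately after `x` on the way outwards; the vertices of `C` are hubs, each of
which precedes the innermost vertices of all arms. -/
def HubStep (C : Type*) (N : J → ℕ) : Arm N ⊕ C → Arm N ⊕ C → Prop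
  | .inr _, .inl q => q.2.val = 0
  | .inl p, .inl q => p.1 = q.1 ∧ p.2.val + 1 = q.2.val
  | _, .inr _ => False

/-- Disjoint paths, together with vertices joined to one end of each path. For `C` empty this is a
union of paths, for `C` a singleton it is a spider. -/
def hubGraph (C : Type*) (N : J → ℕ) : SimpleGraph (Arm N ⊕ C) :=
  SimpleGraph.fromRel (HubStep C N)

variable {N : J → ℕ}

@[simp]
theorem hubGraph_adj_inr_inl (c : C) (q : Arm N) :
    (hubGraph C N).Adj (.inr c) (.inl q) ↔ q.2.val = 0 := by
  simp [hubGraph, HubStep]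

@[simp]
theorem hubGraph_adj_inl_inr (p : Arm N) (c : C) :
    (hubGraph C N).Adj (.inl p) (.inr c) ↔ p.2.val = 0 := by
  simp [hubGraph, HubStep]

@[simp]
theorem not_hubGraph_adj_inr_inr (c c' : C) : ¬(hubGraph C N).Adj (.inr c) (.inr c') := by
  simp [hubGraph, HubStep]

@[simp]
theorem hubGraph_adj_inl_inl (p q : Arm N) : (hubGraph C N).Adj (.inl p) (.inl q) ↔
    p.1 = q.1 ∧ (p.2.val + 1 = q.2.val ∨ q.2.val + 1 = p.2.val) := by
  simp only [hubGraph, SimpleGraph.fromRel_adj, HubStep, ne_eq, Sum.inl.injEq]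
  grind

/-- Positions along an arm alternate in colour, as do a hub and the innermost vertices. -/
def hubColouring (C : Type*) (N : J → ℕ) : (hubGraph C N).Coloring Bool :=
  .mk (Sum.elim (fun p => decide (Odd p.2.val)) fun _ => true) fun {x y} hxy => by
    rcases x with p | c <;> rcases y with q | c'
    · obtain ⟨-, h | h⟩ := (hubGraph_adj_inl_inl p q).1 hxy <;> grind
    · simp_all
    · simp_all
    · simp at hxy

@[simp]
theorem hubColouring_inl (p : Arm N) : hubColouring C N (.inl p) = decide (Odd p.2.val) := rfl

@[simp]
theorem hubColouring_inr (c : C) : hubColouring C N (.inr c) = true := rfl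

section Equitable

variable {s : Setoid (Arm N ⊕ C)}

open scoped Classical in
/-- The indicator of the cell of `z` at position `r` of the `j`-th arm, extended by zero beyond the
end of the arm. -/
def armIndicator (s : Setoid (Arm N ⊕ C)) (z : Arm N ⊕ C) (j : J) (r : ℕ) : ZMod 2 :=
  if ∃ h : r < N j, s z (.inl ⟨j, r, h⟩) then 1 else 0

theorem armIndicator_eq_one {z : Arm N ⊕ C} {j : J} {r : ℕ} :
    armIndicator s z j r = 1 ↔ ∃ h : r < N j, s z (.inl ⟨j, r, h⟩) := by
  simp [armIndicator]

theorem armIndicator_comm {j j' : J} {r r' : ℕ} (h : r < N j) (h' : r' < N j') :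
    armIndicator s (.inl ⟨j, r, h⟩) j' r' = armIndicator s (.inl ⟨j', r', h'⟩) j r := by
  classical
  exact if_congr ⟨fun hz => ⟨h, s.symm' hz.2⟩, fun hz => ⟨h', s.symm' hz.2⟩⟩ rfl rfl

theorem armIndicator_congr {z : Arm N ⊕ C} {j j' : J} {r r' : ℕ} (h : r < N j) (h' : r' < N j')
    (hs : s (.inl ⟨j, r, h⟩) (.inl ⟨j', r', h'⟩)) :
    armIndicator s z j r = armIndicator s z j' r' := by
  classical
  exact if_congr ⟨fun hz => ⟨h', s.trans' hz.2 hs⟩, fun hz => ⟨h, s.trans' hz.2 (s.symm' hs)⟩⟩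
    rfl rfl

open scoped Classical in
theorem armIndicator_eq_sum (z : Arm N ⊕ C) (j : J) (r : ℕ) :
    armIndicator s z j r = ∑ i : Fin (N j), if i.val = r ∧ s z (.inl ⟨j, i⟩) then 1 else 0 := by
  by_cases h : r < N j
  · rw [sum_eq_single ⟨r, h⟩ (fun i _ hi => if_neg fun H => hi (Fin.ext H.1)) (by simp)]
    simp [armIndicator, h]
  · rw [armIndicator, if_neg fun H => h H.1, sum_eq_zero]
    exact fun i _ => if_neg fun H => h (lt_of_eq_of_lt H.1.symm i.2)

variable [Fintype J] [Fintype C]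

open scoped Classical in
theorem degreeParity_cell_inl (z : Arm N ⊕ C) (j : J) (r : ℕ) (hr : r < N j) :
    degreeParity (hubGraph C N) (cell s z) (.inl ⟨j, r, hr⟩) =
      (if r = 0 then ∑ c, if s z (.inr c) then 1 else 0 else armIndicator s z j (r - 1)) +
        armIndicator s z j (r + 1) := by
  have harm : ∑ p : Arm N, (if s z (.inl p) ∧ (hubGraph C N).Adj (.inl ⟨j, r, hr⟩) (.inl p)
      then (1 : ZMod 2) else 0) =
      (if r = 0 then 0 else armIndicator s z j (r - 1)) + armIndicator s z j (r + 1) := by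
    rw [Fintype.sum_sigma, Fintype.sum_eq_single j (by simp +contextual [eq_comm])]
    rcases r with - | r
    · simp [armIndicator_eq_sum, and_comm, eq_comm]
    · rw [if_neg r.succ_ne_zero, armIndicator_eq_sum, armIndicator_eq_sum, ← sum_add_distrib]
      refine sum_congr rfl fun i _ => ?_
      simp only [hubGraph_adj_inl_inl]
      grind
  rw [degreeParity_eq_sum, cell, sum_filter, Fintype.sum_sum_type]
  simp only [← ite_and, harm, hubGraph_adj_inl_inr]
  split_ifs with h0 <;> simp [h0, add_comm]

/-- Walking outwards from two equivalent innermost vertices, equitability determines the cell of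
each vertex from those of its two predecessors; the hubs contribute equally to both arms. -/
theorem IsEquitable.armIndicator_eq (hs : IsEquitable (hubGraph C N) s) {p q : J}
    (hp : 0 < N p) (hq : 0 < N q) (hpq : s (.inl ⟨p, 0, hp⟩) (.inl ⟨q, 0, hq⟩)) (r : ℕ)
    (z : Arm N ⊕ C) : armIndicator s z p r = armIndicator s z q r := by
  induction r using Nat.twoStepInduction generalizing z with
  | zero => exact armIndicator_congr hp hq hpq
  | one => simpa [degreeParity_cell_inl] using hs z hpq
  | more r ih ih' =>
    by_cases hpr : r + 1 < N p
    · obtain ⟨hqr, hpqr⟩ := armIndicator_eq_one.1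
        ((ih' (.inl ⟨p, r + 1, hpr⟩)).symm.trans (armIndicator_eq_one.2 ⟨hpr, s.refl' _⟩))
      simpa [degreeParity_cell_inl, ih] using hs z hpqr
    · have hqr : ¬r + 1 < N q := fun hqr => hpr (armIndicator_eq_one.1
        ((ih' (.inl ⟨q, r + 1, hqr⟩)).trans (armIndicator_eq_one.2 ⟨hqr, s.refl' _⟩))).1
      rw [armIndicator, armIndicator, if_neg fun h => hpr (by grind),
        if_neg fun h => hqr (by grind)]

theorem IsEquitable.eq_of_innermost (hs : IsEquitable (hubGraph C N) s)
    (hN : Function.Injective N) {p q : J} (hp : 0 < N p) (hq : 0 < N q)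
    (hpq : s (.inl ⟨p, 0, hp⟩) (.inl ⟨q, 0, hq⟩)) : p = q := by
  refine hN (eq_of_forall_lt_iff fun r => ⟨fun hr => ?_, fun hr => ?_⟩)
  · exact (armIndicator_eq_one.1 ((hs.armIndicator_eq hp hq hpq r (.inl ⟨p, r, hr⟩)).symm.trans
      (armIndicator_eq_one.2 ⟨hr, s.refl' _⟩))).1
  · exact (armIndicator_eq_one.1 ((hs.armIndicator_eq hp hq hpq r (.inl ⟨q, r, hr⟩)).trans
      (armIndicator_eq_one.2 ⟨hr, s.refl' _⟩))).1

/-- If `(p, 0)` were equivalent to a vertex further out with neighbours `b` and `c`, then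
`a = (p, 1)` would satisfy
`1 = [a ~ a] = [a ~ b] + [a ~ c] = ([b ~ b] + [b ~ c]) + ([c ~ b] + [c ~ c]) = 0` modulo two. -/
theorem IsEquitable.innermost_of_isEmpty [IsEmpty C] (hs : IsEquitable (hubGraph C N) s)
    (hcol : s ≤ Setoid.ker (hubColouring C N)) (hN : Function.Injective N)
    (heven : ∀ j, Even (N j)) {p : J} (hp : 0 < N p) {y : Arm N ⊕ C}
    (hy : s (.inl ⟨p, 0, hp⟩) y) : y = .inl ⟨p, 0, hp⟩ := by
  obtain ⟨q, r, hr⟩ | c := y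
  swap
  · exact isEmptyElim c
  have heven_r : Even r := by simpa [Setoid.ker_def] using hcol hy
  have hp1 : 1 < N p := by grind
  have hr1 : r + 1 < N q := by grind
  obtain - | - | r := r
  · obtain rfl := hs.eq_of_innermost hN hp hr hy
    rfl
  · simp at heven_r
  have hrefl {j : J} {i : ℕ} (hi : i < N j) : armIndicator s (.inl ⟨j, i, hi⟩) j i = 1 :=
    armIndicator_eq_one.2 ⟨hi, s.refl' _⟩
  have key (z) : armIndicator s z p 1 =
      armIndicator s z q (r + 1) + armIndicator s z q (r + 3) := by
    simpa [degreeParity_cell_inl] using hs z hy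
  have ha := key (.inl ⟨p, 1, hp1⟩)
  have hb := key (.inl ⟨q, r + 1, by lia⟩)
  have hc := key (.inl ⟨q, r + 3, hr1⟩)
  rw [hrefl, armIndicator_comm hp1 (by lia), armIndicator_comm hp1 hr1, hb, hc, hrefl, hrefl,
    armIndicator_comm hr1 (by lia), add_comm _ (1 : ZMod 2), CharTwo.add_self_eq_zero] at ha
  exact absurd ha one_ne_zero

open scoped Classical in
theorem degreeParity_cell_inr (z : Arm N ⊕ C) (c : C) :
    degreeParity (hubGraph C N) (cell s z) (.inr c) = ∑ j, armIndicator s z j 0 := by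
  rw [degreeParity_eq_sum, cell, sum_filter, Fintype.sum_sum_type, Fintype.sum_sigma]
  simp [armIndicator_eq_sum, ← ite_and, and_comm]

/-- Every innermost vertex `(p, 0)` has an odd number of equivalents among the neighbours of the
hub, hence also among the at most two neighbours of any other vertex equivalent to the hub. -/
theorem IsEquitable.hub_of_two_lt_card [Unique C] (hs : IsEquitable (hubGraph C N) s)
    (hcol : s ≤ Setoid.ker (hubColouring C N)) (hN : Function.Injective N)
    (hpos : ∀ j, 0 < N j) (hJ : 2 < Fintype.card J) : cell s (.inr default) = {.inr default} := by
  ext y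
  simp only [mem_cell, mem_singleton]
  refine ⟨fun hy => ?_, fun hy => hy ▸ s.refl' _⟩
  obtain ⟨q, r, hr⟩ | c := y
  swap
  · rw [Unique.eq_default c]
  obtain ⟨i, rfl⟩ : Odd r := by simpa [Setoid.ker_def] using hcol hy
  exfalso
  have hodd (p : J) : armIndicator s (.inl ⟨p, 0, hpos p⟩) q (2 * i) +
      armIndicator s (.inl ⟨p, 0, hpos p⟩) q (2 * i + 2) = 1 := by
    have hp := hs (.inl ⟨p, 0, hpos p⟩) hy
    rw [degreeParity_cell_inr, Fintype.sum_eq_single p, degreeParity_cell_inl _ _ _ hr] at hp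
    · simpa [armIndicator_eq_one.2 ⟨hpos p, s.refl' _⟩] using hp.symm
    · exact fun j hj => (zmod_two_eq_zero_or_one _).resolve_right fun h =>
        hj (hs.eq_of_innermost hN (hpos p) (hpos j) (armIndicator_eq_one.1 h).2).symm
  have hnear (p : J) : ∃ b : Bool,
      armIndicator s (.inl ⟨p, 0, hpos p⟩) q (2 * i + if b then 2 else 0) = 1 := by
    by_contra! h
    have h0 := (zmod_two_eq_zero_or_one _).resolve_right (h false)
    have h1 := (zmod_two_eq_zero_or_one _).resolve_right (h true)
    exact zero_ne_one (((hodd p).symm.trans (congrArg₂ (· + ·) h0 h1)).trans (add_zero 0)).symm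
  choose b hb using hnear
  obtain ⟨p, p', hne, hpp'⟩ := Fintype.exists_ne_map_eq_of_card_lt b (by simpa using hJ)
  have hp := (armIndicator_eq_one.1 (hb p)).2
  have hp' := (armIndicator_eq_one.1 (hb p')).2
  simp only [hpp'] at hp
  exact hne (hs.eq_of_innermost hN (hpos p) (hpos p') (s.trans' hp (s.symm' hp')))

end Equitable

section Rigid

variable [Fintype J] [Fintype C]

/-- Zero forcing: a singleton cell propagates from the innermost vertices outwards. -/
theorem IsEquitable.eq_bot_of_innermost {s : Setoid (Arm N ⊕ C)} (hs : IsEquitable (hubGraph C N) s)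
    (hhub : ∀ c, cell s (.inr c) = {.inr c})
    (hinner : ∀ j (hj : 0 < N j), cell s (.inl ⟨j, 0, hj⟩) = {.inl ⟨j, 0, hj⟩}) : s = ⊥ := by
  have harm (j : J) (r : ℕ) (hr : r < N j) : cell s (.inl ⟨j, r, hr⟩) = {.inl ⟨j, r, hr⟩} := by
    induction r using Nat.strong_induction_on with
    | _ r ih =>
      obtain - | r := r
      · exact hinner j hr
      · refine hs.cell_eq_singleton_of_adj (ih r r.lt_succ_self (by lia)) (by simp) ?_
        rintro (⟨i, t, ht⟩ | c) hadj hne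
        · obtain ⟨rfl, ht⟩ := (hubGraph_adj_inl_inl _ _).1 hadj
          obtain rfl | ht : t = r + 1 ∨ t + 1 = r := ht.imp_left Eq.symm
          · exact absurd rfl hne
          · exact ih t (by lia) _
        · exact hhub c
  refine eq_bot_of_cell_eq_singleton ?_
  rintro (⟨j, r, hr⟩ | c)
  · exact harm j r hr
  · exact hhub c

theorem isRigid_hubColouring_of_isEmpty [IsEmpty C] (hN : Function.Injective N)
    (heven : ∀ j, Even (N j)) : IsRigid (hubGraph C N) (hubColouring C N) :=
  fun _ hcol hs => hs.eq_bot_of_innermost isEmptyElim fun _ hj =>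
    cell_eq_singleton_iff.2 fun _ hy => hs.innermost_of_isEmpty hcol hN heven hj hy

theorem isRigid_hubColouring_of_unique [Unique C] (hN : Function.Injective N)
    (hpos : ∀ j, 0 < N j) (hJ : 2 < Fintype.card J) :
    IsRigid (hubGraph C N) (hubColouring C N) := by
  intro s hcol hs
  have hhub := hs.hub_of_two_lt_card hcol hN hpos hJ
  refine hs.eq_bot_of_innermost (fun c => Unique.eq_default c ▸ hhub) fun j hj =>
    cell_eq_singleton_iff.2 fun y hy => ?_
  have hadj := hs.adj_of_cell_eq_singleton hhub (by simp) hy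
  obtain ⟨q, r, hr⟩ | c := y
  · obtain rfl : r = 0 := by simpa using hadj
    obtain rfl := hs.eq_of_innermost hN hj hr hy
    rfl
  · simp at hadj

end Rigid

end HubGraph

section Clifford

open Matrix

variable {A : Type*} [Ring A]

/-- Pairwise anticommuting involutions. -/
structure IsCliffordFamily {ι : Type*} (γ : ι → A) : Prop where
  mul_self (a : ι) : γ a * γ a = 1
  anticommute {a b : ι} : a ≠ b → Anticommute (γ a) (γ b)

variable [Algebra ℝ A]

namespace IsCliffordFamily

variable {ι : Type*} {γ : ι → A}

theorem mul_eq [DecidableEq ι] (H : IsCliffordFamily γ) (a b : ι) :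
    γ a * γ b = (if a = b then (2 : ℝ) else 0) • 1 - γ b * γ a := by
  split_ifs with h
  · rw [h, H.mul_self, two_smul, add_sub_cancel_right]
  · rw [H.anticommute h, zero_smul, zero_sub]

theorem lie_mul [DecidableEq ι] (H : IsCliffordFamily γ) (a b c : ι) :
    ⁅γ a * γ b, γ c⁆ =
      (if b = c then (2 : ℝ) else 0) • γ a - (if a = c then (2 : ℝ) else 0) • γ b := by
  rw [Ring.lie_def, mul_assoc, H.mul_eq b c, mul_sub, ← mul_assoc (γ a), H.mul_eq a c, sub_mul]
  simp only [mul_smul_comm, smul_mul_assoc, mul_one, one_mul, mul_assoc]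
  abel

theorem linearIndependent [Finite ι] [Nontrivial A] (H : IsCliffordFamily γ) :
    LinearIndependent ℝ γ := by
  classical
  cases nonempty_fintype ι
  refine Fintype.linearIndependent_iff.2 fun v hv d => ?_
  have hanti : ∑ a, v a • (γ a * γ d + γ d * γ a) = 0 := by
    have := congrArg₂ (· + ·) (congrArg (· * γ d) hv) (congrArg (γ d * ·) hv)
    simpa [Finset.sum_mul, Finset.mul_sum, ← Finset.sum_add_distrib] using this
  simp only [H.mul_eq _ d, sub_add_cancel] at hanti
  simpa using hanti

end IsCliffordFamily

section SpinMap

variable {ι κ : Type*} [Fintype ι] [Fintype κ]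

/-- The quadratic element `¼ ∑ M a b γ a γ b` attached to a matrix `M`. -/
def spinMap (γ : ι → A) : Matrix ι ι ℝ →ₗ[ℝ] A where
  toFun M := (1 / 4 : ℝ) • ∑ a, ∑ b, M a b • (γ a * γ b)
  map_add' M N := by simp [add_smul, Finset.sum_add_distrib]
  map_smul' c M := by
    simp only [Matrix.smul_apply, smul_eq_mul, mul_smul, ← Finset.smul_sum, RingHom.id_apply]
    rw [smul_comm]

theorem spinMap_apply (γ : ι → A) (M : Matrix ι ι ℝ) :
    spinMap γ M = (1 / 4 : ℝ) • ∑ a, ∑ b, M a b • (γ a * γ b) := rfl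

theorem spinMap_single [DecidableEq ι] (γ : ι → A) (a b : ι) :
    spinMap γ (single a b 1) = (1 / 4 : ℝ) • (γ a * γ b) := by
  simp only [spinMap_apply, single_apply, ite_and, ite_smul, one_smul, zero_smul]
  simp

theorem commute_spinMap {x : A} {γ : ι → A} (h : ∀ a, Commute x (γ a)) (M : Matrix ι ι ℝ) :
    Commute x (spinMap γ M) :=
  (Commute.sum_right _ _ _ fun a _ => Commute.sum_right _ _ _ fun b _ =>
    ((h a).mul_right (h b)).smul_right _).smul_right _

theorem spinMap_mul_transpose (γ : ι → A) (M N : Matrix ι ι ℝ) :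
    spinMap γ (M * Nᵀ) = (1 / 4 : ℝ) • ∑ c,
      Fintype.linearCombination ℝ γ (M.col c) * Fintype.linearCombination ℝ γ (N.col c) := by
  simp only [spinMap_apply, mul_apply, transpose_apply, Finset.sum_smul,
    Fintype.linearCombination_apply, col_apply, Finset.sum_mul_sum, smul_mul_smul_comm]
  congr 1
  exact (Finset.sum_congr rfl fun _ _ => Finset.sum_comm).trans Finset.sum_comm

namespace IsCliffordFamily

variable {γ : ι → A}

/-- Under the commutator, the quadratic element of a skew matrix acts on the span of the family as
the matrix does on vectors. -/
theorem lie_spinMap (H : IsCliffordFamily γ) {M : Matrix ι ι ℝ} (hM : Mᵀ = -M) (c : ι) :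
    ⁅spinMap γ M, γ c⁆ = Fintype.linearCombination ℝ γ (M.col c) := by
  classical
  have hskew (a : ι) : M c a = -M a c := congrFun₂ hM a c
  simp only [spinMap_apply, smul_lie, sum_lie, H.lie_mul, smul_sub, Finset.sum_sub_distrib,
    ite_smul, zero_smul, smul_ite, smul_zero, Finset.sum_ite_irrel, Finset.sum_const_zero,
    Finset.sum_ite_eq', Finset.mem_univ, if_true, hskew, Fintype.linearCombination_apply,
    col_apply, neg_smul, Finset.sum_neg_distrib, smul_comm _ (2 : ℝ),
    ← Finset.smul_sum]
  module

theorem lie_spinMap_linearCombination (H : IsCliffordFamily γ) {M : Matrix ι ι ℝ}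
    (hM : Mᵀ = -M) (v : ι → ℝ) :
    ⁅spinMap γ M, Fintype.linearCombination ℝ γ v⁆ = Fintype.linearCombination ℝ γ (M *ᵥ v) := by
  rw [mulVec_eq_sum, map_sum, Fintype.linearCombination_apply, lie_sum]
  exact Finset.sum_congr rfl fun c _ => by
    rw [lie_smul, H.lie_spinMap hM, op_smul_eq_smul, map_smul]; rfl

theorem spinMap_lie (H : IsCliffordFamily γ) {M N : Matrix ι ι ℝ} (hM : Mᵀ = -M) :
    spinMap γ ⁅M, N⁆ = ⁅spinMap γ M, spinMap γ N⁆ := by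
  classical
  have hone (M : Matrix ι ι ℝ) : spinMap γ M = (1 / 4 : ℝ) • ∑ c,
      Fintype.linearCombination ℝ γ (M.col c) * γ c := by
    simpa [col_apply', one_apply, ← Pi.single_apply] using spinMap_mul_transpose γ M 1
  have hleibniz (x y z : A) : ⁅x, y * z⁆ = ⁅x, y⁆ * z + y * ⁅x, z⁆ := by
    simp only [Ring.lie_def]; noncomm_ring
  calc spinMap γ ⁅M, N⁆ = spinMap γ (M * N) + spinMap γ (N * Mᵀ) := by
        rw [← map_add, hM, Ring.lie_def, mul_neg, sub_eq_add_neg]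
    _ = (1 / 4 : ℝ) • ∑ c, (Fintype.linearCombination ℝ γ (M *ᵥ N.col c) * γ c +
          Fintype.linearCombination ℝ γ (N.col c) * Fintype.linearCombination ℝ γ (M.col c)) := by
        rw [hone, spinMap_mul_transpose, Finset.sum_add_distrib, smul_add]; rfl
    _ = ⁅spinMap γ M, spinMap γ N⁆ := by
        simp only [hone N, lie_smul, lie_sum, hleibniz, H.lie_spinMap_linearCombination hM,
          H.lie_spinMap hM]

/-- The spin representation of `so ι` defined by a Clifford family. -/
def spinHom [DecidableEq ι] (H : IsCliffordFamily γ) :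
    LieAlgebra.Orthogonal.so ι ℝ →ₗ⁅ℝ⁆ A where
  toLinearMap := spinMap γ ∘ₗ (LieAlgebra.Orthogonal.so ι ℝ).toSubmodule.subtype
  map_lie' {M _} := H.spinMap_lie ((LieAlgebra.Orthogonal.mem_so _ _ M.1).1 M.2)

theorem spinHom_apply [DecidableEq ι] (H : IsCliffordFamily γ)
    (M : LieAlgebra.Orthogonal.so ι ℝ) : H.spinHom M = spinMap γ M.val := rfl

theorem mul_mem_range_spinHom [DecidableEq ι] (H : IsCliffordFamily γ) {a b : ι} (hab : a ≠ b) :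
    γ a * γ b ∈ H.spinHom.range := by
  have hskew : (2 : ℝ) • (single a b 1 - single b a 1) ∈ LieAlgebra.Orthogonal.so ι ℝ := by
    rw [LieAlgebra.Orthogonal.mem_so]
    simp [transpose_sub, ← smul_neg]
  have hval : H.spinHom ⟨_, hskew⟩ = γ a * γ b := by
    rw [spinHom_apply, map_smul, map_sub, spinMap_single, spinMap_single, H.anticommute hab.symm]
    module
  exact ⟨_, hval⟩

theorem range_spinHom_le [DecidableEq ι] (H : IsCliffordFamily γ) {L : LieSubalgebra ℝ A}
    (hL : ∀ a b, a ≠ b → γ a * γ b ∈ L) : H.spinHom.range ≤ L := by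
  rintro _ ⟨M, rfl⟩
  change H.spinHom M ∈ L
  rw [spinHom_apply, spinMap_apply]
  refine L.smul_mem _ (sum_mem fun a _ => sum_mem fun b _ => ?_)
  obtain rfl | hab := eq_or_ne a b
  · have hdiag : M.val a a = -M.val a a :=
      congrFun₂ ((LieAlgebra.Orthogonal.mem_so _ _ _).1 M.2) a a
    rw [self_eq_neg.1 hdiag, zero_smul]
    exact L.zero_mem
  · exact L.smul_mem _ (hL a b hab)

end IsCliffordFamily

end SpinMap

section Joint

variable {J : Type*} {ι : J → Type*} [∀ j, Fintype (ι j)]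
  [∀ j, DecidableEq (ι j)] {γ : ∀ j, ι j → A}

/-- Commuting Clifford families. -/
structure AreCommutingCliffordFamilies {ι : J → Type*} (γ : ∀ j, ι j → A) : Prop where
  clifford (j : J) : IsCliffordFamily (γ j)
  commute {i j : J} : i ≠ j → ∀ a b, Commute (γ i a) (γ j b)

namespace AreCommutingCliffordFamilies

theorem lie_spinHom (H : AreCommutingCliffordFamilies γ) :
    Pairwise fun i j => ∀ x y, ⁅(H.clifford i).spinHom x, (H.clifford j).spinHom y⁆ = 0 :=
  fun _ _ hij _ _ => (commute_spinMap (fun b => (commute_spinMap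
    (fun a => (H.commute hij a b).symm) _).symm) _).lie_eq

variable [DecidableEq J]

/-- The joint spin representation of commuting Clifford families. -/
def spinHom (H : AreCommutingCliffordFamilies γ) :
    (⨁ j, LieAlgebra.Orthogonal.so (ι j) ℝ) →ₗ⁅ℝ⁆ A :=
  DirectSum.toLieAlgebra A (fun j => (H.clifford j).spinHom) H.lie_spinHom

theorem spinHom_lof (H : AreCommutingCliffordFamilies γ) (j : J)
    (M : LieAlgebra.Orthogonal.so (ι j) ℝ) :
    H.spinHom (DirectSum.lof ℝ J (fun j => LieAlgebra.Orthogonal.so (ι j) ℝ) j M) =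
      (H.clifford j).spinHom M :=
  DirectSum.toModule_lof _ _ _

theorem spinHom_apply [Fintype J] (H : AreCommutingCliffordFamilies γ)
    (x : ⨁ j, LieAlgebra.Orthogonal.so (ι j) ℝ) :
    H.spinHom x = ∑ j, (H.clifford j).spinHom (x j) := by
  conv_lhs => rw [← DirectSum.sum_univ_of x]
  rw [map_sum]
  exact Finset.sum_congr rfl fun j _ => H.spinHom_lof j (x j)

theorem spinHom_injective [Finite J] [Nontrivial A] (H : AreCommutingCliffordFamilies γ) :
    Function.Injective H.spinHom := by
  cases nonempty_fintype J
  refine (injective_iff_map_eq_zero _).2 fun x hx => ?_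
  ext j : 1
  refine Subtype.ext (Matrix.ext fun a c => ?_)
  have hcol : ⁅(H.clifford j).spinHom (x j), γ j c⁆ = 0 := by
    refine Eq.trans (Eq.symm ?_) (congrArg (⁅·, γ j c⁆) hx |>.trans (zero_lie _))
    rw [H.spinHom_apply, sum_lie]
    refine Finset.sum_eq_single j (fun i _ hij => ?_) (by simp)
    exact (commute_spinMap (fun a => (H.commute hij a c).symm) _).symm.lie_eq
  rw [IsCliffordFamily.spinHom_apply,
    (H.clifford j).lie_spinMap ((LieAlgebra.Orthogonal.mem_so _ _ _).1 (x j).2)] at hcol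
  exact Fintype.linearIndependent_iff.1 (H.clifford j).linearIndependent _ hcol a

theorem range_spinHom [Finite J] (H : AreCommutingCliffordFamilies γ) :
    H.spinHom.range = ⨆ j, (H.clifford j).spinHom.range := by
  cases nonempty_fintype J
  refine le_antisymm ?_ (iSup_le fun j => ?_)
  · rintro _ ⟨x, rfl⟩
    change H.spinHom x ∈ _
    rw [H.spinHom_apply]
    exact sum_mem fun j _ => le_iSup (fun j => (H.clifford j).spinHom.range) j ⟨x j, rfl⟩
  · rintro _ ⟨M, rfl⟩
    exact ⟨_, H.spinHom_lof j M⟩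

end AreCommutingCliffordFamilies

end Joint

end Clifford

section Majorana

variable {A : Type*} [Ring A] {N : ℕ}

/-- Square roots of `-1` forming a path in which exactly the consecutive ones anticommute,
together with an involution that anticommutes with the first of them only. -/
structure IsMajoranaChain (Ξ : A) (g : Fin N → A) : Prop extends
    IsFrustrationFamily (SimpleGraph.pathGraph N) g where
  root_mul_self : Ξ * Ξ = 1
  root_anticommute {i : Fin N} : i.val = 0 → Anticommute Ξ (g i)
  root_commute {i : Fin N} : i.val ≠ 0 → Commute Ξ (g i)

/-- The Jordan–Wigner products `Ξ g₀ ⋯ gₐ₋₁`. -/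
def majorana (Ξ : A) (g : Fin N → A) (a : Fin (N + 1)) : A := Ξ * Fin.partialProd g a

@[simp]
theorem majorana_zero (Ξ : A) (g : Fin N → A) : majorana Ξ g 0 = Ξ := by simp [majorana]

theorem majorana_succ (Ξ : A) (g : Fin N → A) (i : Fin N) :
    majorana Ξ g i.succ = majorana Ξ g i.castSucc * g i := by
  rw [majorana, Fin.partialProd_succ, ← mul_assoc, majorana]

theorem commute_majorana {x Ξ : A} {g : Fin N → A} (hΞ : Commute x Ξ) (hg : ∀ i, Commute x (g i))
    (a : Fin (N + 1)) : Commute x (majorana Ξ g a) := by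
  induction a using Fin.induction with
  | zero => simpa using hΞ
  | succ i ih => exact majorana_succ Ξ g i ▸ ih.mul_right (hg i)

namespace IsMajoranaChain

variable {Ξ : A} {g : Fin N → A}

theorem majorana_generator_relations (H : IsMajoranaChain Ξ g) (a : Fin (N + 1)) (i : Fin N) :
    (i.val = a ∨ i.val + 1 = a → Anticommute (majorana Ξ g a) (g i)) ∧
      (¬(i.val = a ∨ i.val + 1 = a) → Commute (majorana Ξ g a) (g i)) := by
  induction a using Fin.induction with
  | zero =>
    simp only [majorana_zero, Fin.val_zero, Nat.succ_ne_zero, or_false]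
    exact ⟨H.root_anticommute, H.root_commute⟩
  | succ k ih =>
    obtain ⟨ihanti, ihcomm⟩ := ih
    simp only [majorana_succ, Fin.val_succ, Fin.val_castSucc] at ihanti ihcomm ⊢
    have hadj : (SimpleGraph.pathGraph N).Adj k i ↔ k.val + 1 = i.val ∨ i.val + 1 = k.val :=
      SimpleGraph.pathGraph_adj
    refine ⟨?_, fun hne => ?_⟩
    · rintro (h | h)
      · exact (H.anticommute (hadj.2 (by lia))).commute_mul_left (ihcomm (by lia))
      · obtain rfl : k = i := Fin.ext (by lia)
        exact (ihanti (by lia)).mul_commute_left (Commute.refl _)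
    · by_cases h : i.val + 1 = k
      · exact (ihanti (by lia)).mul_left (H.anticommute (hadj.2 (by lia)))
      · exact (ihcomm (by lia)).mul_left (H.commute (mt hadj.1 (by lia)))

theorem majorana_mul_self (H : IsMajoranaChain Ξ g) (a : Fin (N + 1)) :
    majorana Ξ g a * majorana Ξ g a = 1 := by
  induction a using Fin.induction with
  | zero => simpa using H.root_mul_self
  | succ i ih =>
    have hanti := (H.majorana_generator_relations i.castSucc i).1 (by simp)
    rw [majorana_succ, mul_assoc, ← mul_assoc (g i), hanti.symm, neg_mul, mul_assoc,
      H.mul_self i, mul_neg_one, neg_neg, ih]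

theorem anticommute_majorana (H : IsMajoranaChain Ξ g) {a b : Fin (N + 1)} (hab : a < b) :
    Anticommute (majorana Ξ g b) (majorana Ξ g a) := by
  induction b using Fin.induction with
  | zero => exact absurd hab (Fin.not_lt_zero _)
  | succ i ih =>
    rw [majorana_succ]
    obtain hlt | rfl := (Fin.le_castSucc_iff.2 hab).lt_or_eq
    · have hlt' : a.val < i.val := hlt
      exact (ih hlt).mul_commute_left ((H.majorana_generator_relations a i).2 (by lia)).symm
    · have hself := (H.majorana_generator_relations i.castSucc i).1 (by simp)
      exact hself.symm.commute_mul_left (Commute.refl _)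

theorem isCliffordFamily (H : IsMajoranaChain Ξ g) : IsCliffordFamily (majorana Ξ g) where
  mul_self := H.majorana_mul_self
  anticommute hab := hab.lt_or_gt.elim (fun h => (H.anticommute_majorana h).symm)
    H.anticommute_majorana

theorem majorana_mul_majorana_succ (H : IsMajoranaChain Ξ g) (i : Fin N) :
    majorana Ξ g i.castSucc * majorana Ξ g i.succ = g i := by
  rw [majorana_succ, ← mul_assoc, H.majorana_mul_self, one_mul]

variable [Algebra ℝ A]

theorem mul_mem (H : IsMajoranaChain Ξ g) {L : LieSubalgebra ℝ A} (hL : ∀ i, g i ∈ L)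
    {a b : Fin (N + 1)} (hab : a < b) : majorana Ξ g a * majorana Ξ g b ∈ L := by
  induction b using Fin.induction with
  | zero => exact absurd hab (Fin.not_lt_zero _)
  | succ i ih =>
    obtain hlt | rfl := (Fin.le_castSucc_iff.2 hab).lt_or_eq
    · have hlt' : a.val < i.val := hlt
      rw [majorana_succ, ← mul_assoc]
      exact Anticommute.mul_mem (((H.majorana_generator_relations _ i).1 (by simp)).commute_mul_left
        ((H.majorana_generator_relations a i).2 (by lia))) (ih hlt) (hL i)
    · rw [H.majorana_mul_majorana_succ]
      exact hL i

theorem range_spinHom (H : IsMajoranaChain Ξ g) :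
    H.isCliffordFamily.spinHom.range = LieSubalgebra.lieSpan ℝ A (Set.range g) := by
  have hg (i) : g i ∈ LieSubalgebra.lieSpan ℝ A (Set.range g) :=
    LieSubalgebra.subset_lieSpan (Set.mem_range_self i)
  refine le_antisymm (H.isCliffordFamily.range_spinHom_le fun a b hab => ?_) ?_
  · obtain hlt | hlt := hab.lt_or_gt
    · exact H.mul_mem hg hlt
    · exact H.isCliffordFamily.anticommute hab ▸ neg_mem (H.mul_mem hg hlt)
  · rw [LieSubalgebra.lieSpan_le]
    rintro _ ⟨i, rfl⟩
    rw [← H.majorana_mul_majorana_succ]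
    exact H.isCliffordFamily.mul_mem_range_spinHom Fin.castSucc_lt_succ.ne

end IsMajoranaChain

end Majorana

section Dimension

/-- The entries above the diagonal, as coordinates on the skew-symmetric matrices. -/
def soEquiv (n : ℕ) : LieAlgebra.Orthogonal.so (Fin n) ℝ ≃ₗ[ℝ] ((Σ b : Fin n, Fin b) → ℝ) where
  toFun M p := M.val (p.2.castLE p.1.is_lt.le) p.1
  map_add' _ _ := rfl
  map_smul' _ _ := rfl
  invFun f := ⟨Matrix.of fun a b => if h : a < b then f ⟨b, ⟨a, h⟩⟩ else
    if h : b < a then -f ⟨a, ⟨b, h⟩⟩ else 0, by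
      rw [LieAlgebra.Orthogonal.mem_so]
      ext a b
      obtain h | rfl | h := lt_trichotomy a b <;> simp [*, not_lt_of_gt]⟩
  left_inv M := by
    have hskew (a b) : M.val a b = -M.val b a :=
      congrFun₂ ((LieAlgebra.Orthogonal.mem_so _ _ _).1 M.2) b a
    refine Subtype.ext (Matrix.ext fun a b => ?_)
    obtain h | rfl | h := lt_trichotomy a b
    · simp [h]
    · simp [self_eq_neg.1 (hskew a a)]
    · simp [h, h.not_gt, hskew a b]
  right_inv f := by
    funext ⟨b, a⟩
    have h : a.castLE b.is_lt.le < b := a.is_lt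
    simp [h]

theorem finrank_so (n : ℕ) :
    Module.finrank ℝ (LieAlgebra.Orthogonal.so (Fin n) ℝ) = n * (n - 1) / 2 := by
  rw [(soEquiv n).finrank_eq, Module.finrank_fintype_fun_eq_card, Fintype.card_sigma]
  simp only [Fintype.card_fin]
  rw [Fin.sum_univ_eq_sum_range (fun i => i), Finset.sum_range_id]

theorem finrank_directSum_so {J : Type*} [Fintype J] (m : J → ℕ) :
    Module.finrank ℝ (⨁ j, LieAlgebra.Orthogonal.so (Fin (2 * m j + 1)) ℝ) =
      2 * ∑ j, m j ^ 2 + ∑ j, m j := by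
  have hfin (j : J) : Module.Finite ℝ (LieAlgebra.Orthogonal.so (Fin (2 * m j + 1)) ℝ) :=
    Module.Finite.equiv (soEquiv _).symm
  classical
  rw [Module.finrank_directSum, Finset.mul_sum, ← Finset.sum_add_distrib]
  refine Finset.sum_congr rfl fun j _ => ?_
  rw [finrank_so, Nat.div_eq_of_eq_mul_right two_pos]
  rw [Nat.add_sub_cancel]
  ring

end Dimension

section PauliString

open Finset
open scoped symmDiff

variable {W : Type}

/-- The eigenvalue of `∏ w ∈ T, Z w` on the basis state `x`. -/
def zSign (T : Finset W) (x : W → Bool) : ℂ := ∏ w ∈ T, if x w then -1 else 1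

theorem zSign_mul_self (T : Finset W) (x : W → Bool) : zSign T x * zSign T x = 1 := by
  rw [zSign, ← prod_mul_distrib]
  exact prod_eq_one fun w _ => by split_ifs <;> simp

variable [DecidableEq W]

/-- The bit string `x` with the bits in `S` flipped. -/
def flipBits (S : Finset W) (x : W → Bool) (w : W) : Bool := xor (decide (w ∈ S)) (x w)

theorem flipBits_flipBits (S T : Finset W) (x : W → Bool) :
    flipBits S (flipBits T x) = flipBits (S ∆ T) x := by
  funext w
  simp only [flipBits, ← Bool.xor_assoc]
  by_cases hS : w ∈ S <;> by_cases hT : w ∈ T <;> simp [hS, hT, mem_symmDiff]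

theorem zSign_flipBits (S T : Finset W) (x : W → Bool) :
    zSign T (flipBits S x) = (-1) ^ #(T ∩ S) * zSign T x := by
  rw [zSign, zSign, ← filter_mem_eq_inter, card_filter, ← prod_pow_eq_pow_sum, ← prod_mul_distrib]
  refine prod_congr rfl fun w _ => ?_
  by_cases hS : w ∈ S <;> cases hx : x w <;> simp [flipBits, hS, hx]

variable [Fintype W]

/-- The Pauli string `∏ w ∈ S, X w`. -/
def xString (S : Finset W) : Op W := Matrix.of fun x y => if x = flipBits S y then 1 else 0

/-- The Pauli string `∏ w ∈ T, Z w`. -/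
def zString (T : Finset W) : Op W := Matrix.diagonal (zSign T)

theorem xString_mul_xString (S T : Finset W) : xString S * xString T = xString (S ∆ T) := by
  ext x y
  simp [xString, Matrix.mul_apply, flipBits_flipBits]

theorem xString_commute (S T : Finset W) : Commute (xString S) (xString T) := by
  rw [Commute, SemiconjBy, xString_mul_xString, xString_mul_xString, symmDiff_comm]

theorem xString_mul_self (S : Finset W) : xString S * xString S = 1 := by
  rw [xString_mul_xString, symmDiff_self]
  ext x y
  simp [xString, Matrix.one_apply, funext_iff, flipBits]

theorem zString_mul_self (T : Finset W) : zString T * zString T = 1 := by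
  simp [zString, Matrix.diagonal_mul_diagonal, zSign_mul_self]

theorem zString_commute (S T : Finset W) : Commute (zString S) (zString T) := by
  simp only [Commute, SemiconjBy, zString, Matrix.diagonal_mul_diagonal, mul_comm]

theorem zString_mul_xString (S T : Finset W) :
    zString T * xString S = (-1 : ℂ) ^ #(T ∩ S) • (xString S * zString T) := by
  ext x y
  simp only [zString, xString, Matrix.diagonal_mul, Matrix.mul_diagonal, Matrix.of_apply,
    Matrix.smul_apply, smul_eq_mul]
  split_ifs with h
  · rw [h, zSign_flipBits, mul_one, one_mul]
  · simp

theorem xString_anticommute_zString {S T : Finset W} (h : Odd #(T ∩ S)) :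
    Anticommute (xString S) (zString T) := by
  refine Anticommute.symm ?_
  rw [Anticommute, zString_mul_xString, h.neg_one_pow, neg_one_smul]

theorem xString_commute_zString {S T : Finset W} (h : Even #(T ∩ S)) :
    Commute (xString S) (zString T) := by
  refine Commute.symm ?_
  rw [Commute, SemiconjBy, zString_mul_xString, h.neg_one_pow, one_smul]

theorem xString_singleton (w : W) : xString {w} = pauliX w := by
  have hflip (y : W → Bool) : flipBits {w} y = Function.update y w (!(y w)) := by
    funext v
    obtain rfl | h := eq_or_ne v w <;> simp [flipBits, *]
  simp [xString, pauliX, hflip]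

theorem zString_singleton (w : W) : zString {w} = pauliZ w := by
  simp [zString, pauliZ, zSign]

theorem zString_pair {v w : W} (h : v ≠ w) : zString {v, w} = pauliZZ s(v, w) := by
  simp [zString, pauliZZ, pauliZ, zSign, prod_pair h, Matrix.diagonal_mul_diagonal]

theorem linearIndependent_I_smul_xString :
    LinearIndependent ℝ fun S : Finset W => Complex.I • xString S := by
  refine Fintype.linearIndependent_iff.2 fun v hv T => ?_
  have hentry := congrFun₂ hv (fun w => decide (w ∈ T)) fun _ => false
  have hindic (S : Finset W) : (fun w => decide (w ∈ T)) = flipBits S (fun _ => false) ↔ T = S := by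
    simp [funext_iff, flipBits, Finset.ext_iff]
  simpa [Matrix.sum_apply, xString, hindic] using hentry

end PauliString

section HubTerms

open Finset

variable {J C : Type} {m : J → ℕ}

/-- The qubit `⌊r / 2⌋` of the arm at position `r` of the doubled arm, so that the positions `2 i`
and `2 i + 1` stand for the edge entering the `i`-th vertex and for that vertex. -/
def qubit (q : Arm (fun j => 2 * m j) ⊕ C) : Arm m ⊕ C :=
  q.map (fun p => ⟨p.1, ⟨p.2.val / 2, by lia⟩⟩) id

variable {W : Type} [DecidableEq W] [Fintype W] (e : Arm m ⊕ C ≃ W)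

open scoped Classical in
/-- The endpoints of the edge entering the vertex `x`. When there is no hub, an innermost vertex
has no predecessor, and only its own qubit remains. -/
def edgeSupport (x : Arm m ⊕ C) : Finset W :=
  {w | e.symm w = x ∨ HubStep C m (e.symm w) x}

omit [DecidableEq W] in
@[simp]
theorem apply_mem_edgeSupport {x y : Arm m ⊕ C} :
    e y ∈ edgeSupport e x ↔ y = x ∨ HubStep C m y x := by
  simp [edgeSupport]

/-- The terms `i X_w` and `i Z_w Z_w'` of the Hamiltonians, arranged along the hub graph: odd
positions of the doubled arms and hubs carry the former, even positions the latter. -/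
def hubTerm (q : Arm (fun j => 2 * m j) ⊕ C) : Op W :=
  Complex.I •
    if hubColouring C _ q then xString {e (qubit q)} else zString (edgeSupport e (qubit q))

variable {e}

theorem hubTerm_of_colour_true {q : Arm (fun j => 2 * m j) ⊕ C} (hq : hubColouring C _ q = true) :
    hubTerm e q = Complex.I • xString {e (qubit q)} := by
  rw [hubTerm, if_pos hq]

theorem hubTerm_of_colour_false {q : Arm (fun j => 2 * m j) ⊕ C}
    (hq : hubColouring C _ q = false) :
    hubTerm e q = Complex.I • zString (edgeSupport e (qubit q)) := by
  rw [hubTerm, if_neg (by simp [hq])]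

omit [DecidableEq W] in
theorem hubGraph_adj_iff_mem_edgeSupport {q q' : Arm (fun j => 2 * m j) ⊕ C}
    (hq : hubColouring C _ q = true) (hq' : hubColouring C _ q' = false) :
    (hubGraph C _).Adj q q' ↔ e (qubit q) ∈ edgeSupport e (qubit q') := by
  rw [apply_mem_edgeSupport]
  obtain ⟨j', r', hr'⟩ | c' := q'
  swap
  · simp at hq'
  obtain ⟨j, r, hr⟩ | c := q
  · simp only [hubColouring_inl, decide_eq_true_eq, decide_eq_false_iff_not, Nat.odd_iff] at hq hq'
    simp only [qubit, Sum.map_inl, Sum.inl.injEq, hubGraph_adj_inl_inl, HubStep]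
    obtain rfl | hne := eq_or_ne j j'
    · simp only [Sigma.mk.injEq, heq_eq_eq, Fin.mk.injEq, true_and]
      lia
    · simp [hne]
  · simp only [hubColouring_inl, decide_eq_false_iff_not, Nat.not_odd_iff_even,
      Nat.even_iff] at hq'
    simp only [qubit, Sum.map_inl, Sum.map_inr, hubGraph_adj_inr_inl, HubStep, reduceCtorEq,
      false_or]
    lia

theorem hubTerm_anticommute {q q' : Arm (fun j => 2 * m j) ⊕ C}
    (hq : hubColouring C _ q = true) (hq' : hubColouring C _ q' = false)
    (hadj : (hubGraph C _).Adj q q') : Anticommute (hubTerm e q) (hubTerm e q') := by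
  have hmem := (hubGraph_adj_iff_mem_edgeSupport (e := e) hq hq').1 hadj
  rw [hubTerm_of_colour_true hq, hubTerm_of_colour_false hq']
  have hodd : Odd #(edgeSupport e (qubit q') ∩ {e (qubit q)}) := by
    rw [inter_singleton_of_mem hmem, card_singleton]; exact odd_one
  exact (xString_anticommute_zString hodd).smul_smul _ _

theorem hubTerm_commute {q q' : Arm (fun j => 2 * m j) ⊕ C}
    (hq : hubColouring C _ q = true) (hq' : hubColouring C _ q' = false)
    (hadj : ¬(hubGraph C _).Adj q q') : Commute (hubTerm e q) (hubTerm e q') := by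
  have hmem := mt (hubGraph_adj_iff_mem_edgeSupport (e := e) hq hq').2 hadj
  rw [hubTerm_of_colour_true hq, hubTerm_of_colour_false hq']
  have heven : Even #(edgeSupport e (qubit q') ∩ {e (qubit q)}) := by
    rw [inter_singleton_of_notMem hmem, card_empty]; exact Even.zero
  exact ((xString_commute_zString heven).smul_left _).smul_right _

theorem isFrustrationFamily_hubTerm :
    IsFrustrationFamily (hubGraph C fun j => 2 * m j) (hubTerm e) where
  mul_self q := by
    rw [hubTerm, smul_mul_smul_comm, Complex.I_mul_I]
    split_ifs <;> simp [xString_mul_self, zString_mul_self]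
  anticommute {q q'} hadj := by
    have hne := (hubColouring C fun j => 2 * m j).valid hadj
    cases hq : hubColouring C _ q <;> cases hq' : hubColouring C _ q'
    · exact absurd (hq.trans hq'.symm) hne
    · exact (hubTerm_anticommute hq' hq hadj.symm).symm
    · exact hubTerm_anticommute hq hq' hadj
    · exact absurd (hq.trans hq'.symm) hne
  commute {q q'} hadj := by
    cases hq : hubColouring C _ q <;> cases hq' : hubColouring C _ q'
    · rw [hubTerm_of_colour_false hq, hubTerm_of_colour_false hq']
      exact ((zString_commute _ _).smul_left _).smul_right _
    · exact (hubTerm_commute hq' hq (mt SimpleGraph.Adj.symm hadj)).symm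
    · exact hubTerm_commute hq hq' hadj
    · rw [hubTerm_of_colour_true hq, hubTerm_of_colour_true hq']
      exact ((xString_commute _ _).smul_left _).smul_right _

open scoped Classical in
/-- The vertices of the `j`-th arm. -/
def armSupport (e : Arm m ⊕ C ≃ W) (j : J) : Finset W :=
  {w | ∃ i, e.symm w = .inl ⟨j, i⟩}

omit [DecidableEq W] in
@[simp]
theorem apply_mem_armSupport {j : J} {y : Arm m ⊕ C} :
    e y ∈ armSupport e j ↔ ∃ i, y = .inl ⟨j, i⟩ := by
  simp [armSupport]

theorem edgeSupport_succ {j : J} {r : ℕ} (hr : r + 1 < m j) :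
    edgeSupport e (.inl ⟨j, r + 1, hr⟩) =
      {e (.inl ⟨j, r, by lia⟩), e (.inl ⟨j, r + 1, hr⟩)} := by
  ext w
  obtain ⟨⟨i, t, ht⟩ | c, rfl⟩ := e.surjective w
  · obtain rfl | hne := eq_or_ne i j
    · simp [HubStep, or_comm]
    · simp [HubStep, hne]
  · simp [HubStep]

theorem edgeSupport_zero_inter_armSupport {j : J} (hj : 0 < m j) :
    edgeSupport e (.inl ⟨j, 0, hj⟩) ∩ armSupport e j = {e (.inl ⟨j, 0, hj⟩)} := by
  ext w
  obtain ⟨⟨i, t, ht⟩ | c, rfl⟩ := e.surjective w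
  · obtain rfl | hne := eq_or_ne i j
    · simp [HubStep]
    · simp [HubStep, hne]
  · simp [HubStep]

theorem odd_card_edgeSupport_inter_armSupport {i j : J} {r : ℕ} (hr : r < m i) :
    Odd #(edgeSupport e (.inl ⟨i, r, hr⟩) ∩ armSupport e j) ↔ i = j ∧ r = 0 := by
  obtain rfl | hne := eq_or_ne i j
  · obtain - | r := r
    · simp [edgeSupport_zero_inter_armSupport]
    · simp [edgeSupport_succ]
  · suffices edgeSupport e (.inl ⟨i, r, hr⟩) ∩ armSupport e j = ∅ by simp [this, hne]
    refine eq_empty_of_forall_notMem fun w hw => ?_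
    obtain ⟨hedge, harm⟩ := mem_inter.1 hw
    obtain ⟨y, rfl⟩ := e.surjective w
    obtain ⟨t, rfl⟩ := apply_mem_armSupport.1 harm
    have hji : j = i := ((apply_mem_edgeSupport e).1 hedge).elim
      (fun h => congrArg Sigma.fst (Sum.inl_injective h)) And.left
    exact hne hji.symm

theorem xString_armSupport_commute {j : J} {p : Arm fun j => 2 * m j}
    (hp : ¬(p.1 = j ∧ p.2.val = 0)) : Commute (xString (armSupport e j)) (hubTerm e (.inl p)) := by
  cases hcol : hubColouring C _ (.inl p)
  · rw [hubTerm_of_colour_false hcol]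
    refine (xString_commute_zString (Nat.not_odd_iff_even.1 ?_)).smul_right _
    have heven : ¬Odd p.2.val := by simpa using hcol
    refine (odd_card_edgeSupport_inter_armSupport _).not.2 fun h => hp ⟨h.1, ?_⟩
    have := h.2
    grind
  · rw [hubTerm_of_colour_true hcol]
    exact (xString_commute _ _).smul_right _

theorem xString_armSupport_anticommute {j : J} {i : Fin (2 * m j)} (hi : i.val = 0) :
    Anticommute (xString (armSupport e j)) (hubTerm e (.inl ⟨j, i⟩)) := by
  have hodd : Odd #(edgeSupport e (qubit (.inl ⟨j, i⟩)) ∩ armSupport e j) :=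
    (odd_card_edgeSupport_inter_armSupport _).2 ⟨rfl, by simp [hi]⟩
  rw [hubTerm_of_colour_false (by simp [hi])]
  simpa using (xString_anticommute_zString hodd).smul_smul (1 : ℂ) Complex.I

theorem isMajoranaChain_hubTerm (j : J) :
    IsMajoranaChain (xString (armSupport e j)) fun i => hubTerm e (.inl ⟨j, i⟩) where
  mul_self i := isFrustrationFamily_hubTerm.mul_self _
  anticommute {i i'} hadj := isFrustrationFamily_hubTerm.anticommute <| by
    simpa using SimpleGraph.pathGraph_adj.1 hadj
  commute {i i'} hadj := isFrustrationFamily_hubTerm.commute <| by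
    simpa using mt SimpleGraph.pathGraph_adj.2 hadj
  root_mul_self := xString_mul_self _
  root_anticommute := xString_armSupport_anticommute
  root_commute hi := xString_armSupport_commute fun h => hi h.2

variable (e) in
theorem areCommutingCliffordFamilies_hubTerm : AreCommutingCliffordFamilies fun j : J =>
    majorana (xString (armSupport e j)) fun i => hubTerm e (.inl ⟨j, i⟩) where
  clifford j := (isMajoranaChain_hubTerm j).isCliffordFamily
  commute {j j'} hne a b := by
    refine commute_majorana (commute_majorana (xString_commute _ _) (fun i => ?_) a).symm
      (fun i' => (commute_majorana ?_ (fun i => ?_) a).symm) b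
    · exact xString_armSupport_commute fun h => hne h.1
    · exact (xString_armSupport_commute fun h => hne h.1.symm).symm
    · exact isFrustrationFamily_hubTerm.commute (by simp [hne.symm])

variable (e) in
/-- The Lie algebra generated by the terms on the arms, as the image of the spin representation of
the direct sum of the orthogonal algebras of the Majorana chains. -/
def directSumSoEquiv [Finite J] [DecidableEq J] :
    (⨁ j, LieAlgebra.Orthogonal.so (Fin (2 * m j + 1)) ℝ) ≃ₗ⁅ℝ⁆
      LieSubalgebra.lieSpan ℝ (Op W) (Set.range fun p => hubTerm e (.inl p)) :=
  (LieEquiv.ofInjective _ (areCommutingCliffordFamilies_hubTerm e).spinHom_injective).trans <|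
    LieEquiv.ofEq _ _ <| congrArg _ <| by
      rw [AreCommutingCliffordFamilies.range_spinHom, Set.range_sigma_eq_iUnion_range,
        LieSubalgebra.span_iUnion]
      exact iSup_congr fun j => (isMajoranaChain_hubTerm j).range_spinHom

end HubTerms

section ColourSums

open Finset

variable {J C W : Type} {m : J → ℕ}

theorem eq_of_qubit_eq {q q' : Arm (fun j => 2 * m j) ⊕ C}
    (hcol : hubColouring C _ q = hubColouring C _ q') (hqubit : qubit q = qubit q') : q = q' := by
  obtain ⟨j, r, hr⟩ | c := q <;> obtain ⟨j', r', hr'⟩ | c' := q' <;>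
    simp only [qubit, Sum.map_inl, Sum.map_inr, Sum.inl.injEq, Sum.inr.injEq, reduceCtorEq, id,
      hubColouring_inl, decide_eq_decide, Sigma.mk.injEq] at hcol hqubit
  · obtain ⟨rfl, hdiv⟩ := hqubit
    have hdiv := congrArg Fin.val (eq_of_heq hdiv)
    have : r = r' := by grind
    subst this
    rfl
  · rw [hqubit]

theorem exists_qubit_eq_of_colour_true (x : Arm m ⊕ C) :
    ∃ q, hubColouring C _ q = true ∧ qubit q = x := by
  obtain ⟨j, i⟩ | c := x
  · have hdiv : (2 * i.val + 1) / 2 = i := by lia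
    exact ⟨.inl ⟨j, 2 * i.val + 1, by lia⟩, by simp, by simp [qubit, hdiv]⟩
  · exact ⟨.inr c, rfl, rfl⟩

theorem exists_qubit_eq_of_colour_false (p : Arm m) :
    ∃ q : Arm (fun j => 2 * m j) ⊕ C, hubColouring C _ q = false ∧ qubit q = .inl p :=
  ⟨.inl ⟨p.1, 2 * p.2.val, by lia⟩, by simp, by simp [qubit]⟩

theorem exists_qubit_eq_inl_of_colour_false {q : Arm (fun j => 2 * m j) ⊕ C}
    (hq : hubColouring C _ q = false) : ∃ p, qubit q = .inl p := by
  obtain p | c := q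
  · exact ⟨_, rfl⟩
  · simp at hq

variable [Fintype J] [Fintype C] [DecidableEq W] [Fintype W] (e : Arm m ⊕ C ≃ W)

theorem sum_hubTerm_colour_true :
    ∑ q with hubColouring C _ q = true, hubTerm e q = Complex.I • mixer W := by
  rw [mixer, smul_sum]
  refine sum_nbij (fun q => e (qubit q)) (by simp) ?_ ?_ ?_
  · intro q hq q' hq' h
    have hcol : hubColouring C _ q = hubColouring C _ q' := by
      rw [(mem_filter_univ _).1 hq, (mem_filter_univ _).1 hq']
    exact eq_of_qubit_eq hcol (e.injective h)
  · intro w _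
    obtain ⟨q, hq, hqw⟩ := exists_qubit_eq_of_colour_true (e.symm w)
    exact ⟨q, by simpa using hq, by simp [hqw]⟩
  · intro q hq
    rw [hubTerm_of_colour_true (by simpa using hq), xString_singleton]

theorem sum_hubTerm_colour_false : ∑ q with hubColouring C _ q = false, hubTerm e q =
    Complex.I • ∑ p : Arm m, zString (edgeSupport e (.inl p)) := by
  rw [smul_sum]
  symm
  choose q hq hqp using exists_qubit_eq_of_colour_false (C := C) (m := m)
  refine sum_nbij q (by simpa using hq) ?_ ?_ fun p _ => ?_
  · intro p _ p' _ h
    exact Sum.inl_injective (by rw [← hqp p, ← hqp p', h])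
  · intro q' hq'
    replace hq' : hubColouring C _ q' = false := by simpa using hq'
    obtain ⟨p, hp⟩ := exists_qubit_eq_inl_of_colour_false hq'
    exact ⟨p, by simp, eq_of_qubit_eq ((hq p).trans hq'.symm) ((hqp p).trans hp.symm)⟩
  · rw [hubTerm_of_colour_false (hq p), hqp]

variable {e}

theorem hubTerm_mem (hrigid : IsRigid (hubGraph C fun j => 2 * m j) (hubColouring C _))
    {L : LieSubalgebra ℝ (Op W)} (hmixer : Complex.I • mixer W ∈ L)
    (hproblem : Complex.I • ∑ p : Arm m, zString (edgeSupport e (.inl p)) ∈ L)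
    (q : Arm (fun j => 2 * m j) ⊕ C) : hubTerm e q ∈ L := by
  rw [← sum_hubTerm_colour_true e] at hmixer
  rw [← sum_hubTerm_colour_false e] at hproblem
  let _ : NormedRing (Op W) := Matrix.linftyOpNormedRing
  let _ : NormedAlgebra ℝ (Op W) := Matrix.linftyOpNormedAlgebra
  have := FiniteDimensional.complete ℝ (Op W)
  exact isFrustrationFamily_hubTerm.mem_of_isRigid
    (Submodule.closed_of_finiteDimensional L.toSubmodule) _ hrigid
    (Bool.forall_bool.2 ⟨hproblem, hmixer⟩) q

end ColourSums

section EdgeSums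

open Finset

variable {J C W : Type} {m : J → ℕ} {x y z : Arm m ⊕ C} {p : Arm m}

theorem HubStep.adj (h : HubStep C m x y) : (hubGraph C m).Adj x y := by
  obtain p | c := x <;> obtain q | c' := y <;> simp_all [HubStep]

theorem hubGraph_adj_iff : (hubGraph C m).Adj x y ↔ HubStep C m x y ∨ HubStep C m y x :=
  ⟨And.right, fun h => h.elim HubStep.adj fun h => h.adj.symm⟩

theorem HubStep.asymm (h : HubStep C m x y) : ¬HubStep C m y x := by
  obtain p | c := x <;> obtain q | c' := y <;> simp_all only [HubStep, not_false_eq_true]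
  lia

theorem HubStep.exists_eq_inl (h : HubStep C m x y) : ∃ p, y = .inl p := by
  obtain p | c := y
  · exact ⟨p, rfl⟩
  · simp [HubStep] at h

theorem HubStep.left_unique [Subsingleton C] (hx : HubStep C m x z) (hy : HubStep C m y z) :
    x = y := by
  obtain ⟨⟨k, t⟩, rfl⟩ := hx.exists_eq_inl
  obtain ⟨i, r⟩ | c := x <;> obtain ⟨j, s⟩ | c' := y <;> simp only [HubStep] at hx hy
  · obtain ⟨rfl, hr⟩ := hx
    obtain ⟨rfl, hs⟩ := hy
    obtain rfl : r = s := Fin.ext (by lia)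
    rfl
  · lia
  · lia
  · rw [Subsingleton.elim c c']

theorem exists_hubStep_of_nonempty [Nonempty C] (p : Arm m) : ∃ x, HubStep C m x (.inl p) := by
  obtain ⟨j, r, hr⟩ := p
  obtain - | r := r
  · exact ⟨.inr (Classical.arbitrary C), rfl⟩
  · exact ⟨.inl ⟨j, r, by lia⟩, rfl, rfl⟩

theorem exists_hubStep_iff_of_isEmpty [IsEmpty C] :
    (∃ x, HubStep C m x (.inl p)) ↔ p.2.val ≠ 0 := by
  obtain ⟨j, r, hr⟩ := p
  refine ⟨?_, fun h => ⟨.inl ⟨j, r - 1, by lia⟩, rfl, Nat.sub_add_cancel (by lia)⟩⟩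
  rintro ⟨q | c, h⟩
  · exact fun h0 => by simp_all [HubStep]
  · exact isEmptyElim c

theorem exists_hubStep_of_mem_edgeSet {G : SimpleGraph W} (φ : hubGraph C m ≃g G) {E : Sym2 W}
    (hE : E ∈ G.edgeSet) : ∃ x p, HubStep C m x (.inl p) ∧ E = s(φ x, φ (.inl p)) := by
  induction E with
  | _ a b =>
    obtain ⟨x, rfl⟩ := φ.surjective a
    obtain ⟨y, rfl⟩ := φ.surjective b
    obtain h | h := hubGraph_adj_iff.1 (φ.map_adj_iff.1 hE)
    · obtain ⟨p, rfl⟩ := h.exists_eq_inl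
      exact ⟨x, p, h, rfl⟩
    · obtain ⟨p, rfl⟩ := h.exists_eq_inl
      exact ⟨y, p, h, Sym2.eq_swap⟩

variable [DecidableEq W] [Fintype W]

theorem zString_edgeSupport_of_hubStep [Subsingleton C] (e : Arm m ⊕ C ≃ W)
    (h : HubStep C m x y) : zString (edgeSupport e y) = pauliZZ s(e x, e y) := by
  rw [← zString_pair (e.injective.ne h.adj.ne)]
  congr 1
  ext w
  obtain ⟨z, rfl⟩ := e.surjective w
  have hz : HubStep C m z y ↔ z = x := ⟨fun hz => hz.left_unique h, fun hz => hz ▸ h⟩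
  simp [hz, or_comm]

theorem zString_edgeSupport_of_not_hubStep (e : Arm m ⊕ C ≃ W)
    (h : ¬∃ x, HubStep C m x y) : zString (edgeSupport e y) = pauliZ (e y) := by
  rw [← zString_singleton]
  congr 1
  ext w
  obtain ⟨z, rfl⟩ := e.surjective w
  simp [not_exists.1 h z]

theorem sum_pauliZZ_edgeFinset [Subsingleton C] [Fintype J] {G : SimpleGraph W}
    [DecidableRel G.Adj] [DecidablePred fun p : Arm m => ∃ x, HubStep C m x (.inl p)]
    (φ : hubGraph C m ≃g G) : ∑ E ∈ G.edgeFinset, pauliZZ E =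
      ∑ p with ∃ x, HubStep C m x (.inl p), zString (edgeSupport φ.toEquiv (.inl p)) := by
  symm
  have hpred (p) (hp : p ∈ ({p | ∃ x, HubStep C m x (.inl p)} : Finset (Arm m))) :=
    (mem_filter_univ p).1 hp
  choose! pred hpred using hpred
  refine sum_nbij (fun p => s(φ (pred p), φ (.inl p))) ?_ ?_ ?_ ?_
  · intro p hp
    simpa using φ.map_adj_iff.2 (hpred p hp).adj
  · intro p hp q hq hpq
    obtain ⟨-, h⟩ | ⟨h, h'⟩ := by simpa using hpq
    · exact h
    · exact absurd (h' ▸ hpred q hq) (h ▸ hpred p hp).asymm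
  · intro E hE
    obtain ⟨x, p, hstep, rfl⟩ := exists_hubStep_of_mem_edgeSet φ (by simpa using hE)
    have hp : p ∈ ({p | ∃ x, HubStep C m x (.inl p)} : Finset (Arm m)) :=
      (mem_filter_univ p).2 ⟨x, hstep⟩
    exact ⟨p, hp, congrArg (s(φ ·, φ (.inl p))) ((hpred p hp).left_unique hstep)⟩
  · intro p hp
    exact zString_edgeSupport_of_hubStep φ.toEquiv (hpred p hp)

end EdgeSums

section Growth

open Finset
open scoped symmDiff

theorem Anticommute.mul_mem_of_mul_mem {K A : Type*} [Field K] [CharZero K] [Ring A] [Algebra K A]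
    {L : LieSubalgebra K A} {w x y : A} (h : Anticommute x y) (hx : x * x = -1)
    (hwx : Commute w x) (hwy : Commute w y) (hxL : x ∈ L) (hyL : y ∈ L) (hwL : w * x ∈ L) :
    w * y ∈ L := by
  have hwxy : w * x * y ∈ L := (h.commute_mul_left hwy).mul_mem hwL hyL
  have hwxyx : w * x * y * x ∈ L :=
    (h.symm.commute_mul_left (hwx.mul_left (.refl x))).mul_mem hwxy hxL
  have heq : w * x * y * x = w * y := by
    rw [mul_assoc, h.symm, mul_neg, mul_assoc, ← mul_assoc x, hx, neg_one_mul, mul_neg, neg_neg]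
  rwa [← heq]

variable {J C W : Type} [DecidableEq W] [Fintype W] {m : J → ℕ} {e : Arm m ⊕ C ≃ W}
  {L : LieSubalgebra ℝ (Op W)}

theorem mul_hubTerm_inl_mem (hL : ∀ q, hubTerm e q ∈ L) {w : Op W} {j : J}
    (hw : ∀ i, Commute w (hubTerm e (.inl ⟨j, i⟩))) {i₀ : Fin (2 * m j)} (hi₀ : i₀.val = 0)
    (h₀ : w * hubTerm e (.inl ⟨j, i₀⟩) ∈ L) (i : Fin (2 * m j)) :
    w * hubTerm e (.inl ⟨j, i⟩) ∈ L := by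
  obtain ⟨r, hr⟩ := i
  induction r with
  | zero => rwa [show (⟨0, hr⟩ : Fin (2 * m j)) = i₀ from Fin.ext hi₀.symm]
  | succ r ih =>
    refine Anticommute.mul_mem_of_mul_mem (isFrustrationFamily_hubTerm.anticommute ?_)
      (isFrustrationFamily_hubTerm.mul_self _) (hw _) (hw _) (hL _) (hL _) (ih (by lia))
    simp

variable {a b d : J} {i₀ : Fin (2 * m a)}

/-- The three anticommutations with the hub `c` produce the product for the innermost edges, which
is then pushed outwards along two of the arms. -/
theorem hubTerm_mul_hubTerm_mul_hubTerm_mem (hL : ∀ q, hubTerm e q ∈ L) (c : C) (hab : a ≠ b)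
    (had : a ≠ d) (hbd : b ≠ d) (hi₀ : i₀.val = 0) (r : Fin (2 * m b)) (s : Fin (2 * m d)) :
    hubTerm e (.inl ⟨b, r⟩) * hubTerm e (.inl ⟨d, s⟩) * hubTerm e (.inl ⟨a, i₀⟩) ∈ L := by
  have H := isFrustrationFamily_hubTerm (e := e)
  have hcomm {j j' : J} (hne : j ≠ j') (i i') :
      Commute (hubTerm e (.inl ⟨j, i⟩)) (hubTerm e (.inl ⟨j', i'⟩)) := H.commute (by simp [hne])
  have hhub {j : J} {i : Fin (2 * m j)} (hi : i.val = 0) :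
      Anticommute (hubTerm e (.inl ⟨j, i⟩)) (hubTerm e (.inr c)) := H.anticommute (by simpa)
  let b₀ : Fin (2 * m b) := ⟨0, r.pos⟩
  let d₀ : Fin (2 * m d) := ⟨0, s.pos⟩
  set A := hubTerm e (.inl ⟨a, i₀⟩)
  have hAb : A * hubTerm e (.inl ⟨b, b₀⟩) * hubTerm e (.inr c) ∈ L := by
    rw [mul_assoc]
    refine ((hhub hi₀).symm.commute_mul_left (hcomm hab _ _).symm).symm.mul_mem (hL _) ?_
    exact (hhub rfl).mul_mem (hL _) (hL _)
  have hAbd : A * hubTerm e (.inl ⟨b, b₀⟩) * hubTerm e (.inl ⟨d, d₀⟩) ∈ L :=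
    (hhub rfl).symm.mul_mem_of_mul_mem (H.mul_self _) ((hhub hi₀).mul_left (hhub rfl))
      ((hcomm had _ _).mul_left (hcomm hbd _ _)) (hL _) (hL _) hAb
  have hAdb : A * hubTerm e (.inl ⟨d, s⟩) * hubTerm e (.inl ⟨b, b₀⟩) ∈ L := by
    rw [mul_assoc, (hcomm hbd _ _).symm.eq, ← mul_assoc]
    exact mul_hubTerm_inl_mem hL (fun i => (hcomm had _ _).mul_left (hcomm hbd _ _)) rfl hAbd s
  have hfinal := mul_hubTerm_inl_mem hL
    (fun i => (hcomm hab _ _).mul_left (hcomm hbd.symm _ _)) rfl hAdb r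
  rwa [mul_assoc, (hcomm hbd.symm _ _).eq,
    ((hcomm hab _ _).mul_right (hcomm had _ _)).eq] at hfinal

variable (e L) in
/-- The sets of qubits whose Pauli `X`-string lies in `L` and anticommutes with the term of the
edge entering the arm `a`. -/
def anchoredStrings (ha : 0 < m a) : Set (Finset W) :=
  {S | Complex.I • xString S ∈ L ∧ Odd #(edgeSupport e (.inl ⟨a, 0, ha⟩) ∩ S)}

theorem hubTerm_two_mul (p : Arm m) : hubTerm e (.inl ⟨p.1, 2 * p.2.val, by lia⟩) =
    Complex.I • zString (edgeSupport e (.inl p)) := by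
  rw [hubTerm_of_colour_false (by simp)]
  simp [qubit]

theorem hubTerm_two_mul_add_one (p : Arm m) : hubTerm e (.inl ⟨p.1, 2 * p.2.val + 1, by lia⟩) =
    Complex.I • xString {e (.inl p)} := by
  have hdiv : (2 * p.2.val + 1) / 2 = p.2 := by lia
  rw [hubTerm_of_colour_true (by simp)]
  simp [qubit, hdiv]

variable {ha : 0 < m a} {S : Finset W} {p q : Arm m}

theorem singleton_mem_anchoredStrings (hL : ∀ q, hubTerm e q ∈ L) :
    {e (.inl ⟨a, 0, ha⟩)} ∈ anchoredStrings e L ha := by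
  refine ⟨?_, by simp [inter_singleton_of_mem]⟩
  rw [← hubTerm_two_mul_add_one]
  exact hL _

omit [DecidableEq W] in
theorem apply_notMem_edgeSupport (hp : p.1 ≠ a) :
    e (.inl p) ∉ edgeSupport e (.inl ⟨a, 0, ha⟩) := fun h =>
  ((apply_mem_edgeSupport e).1 h).elim
    (fun h => hp (congrArg Sigma.fst (Sum.inl_injective h))) fun h => hp h.1

theorem edgeSupport_inter_symmDiff_singleton (hp : p.1 ≠ a) :
    edgeSupport e (.inl ⟨a, 0, ha⟩) ∩ (S ∆ {e (.inl p)}) =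
      edgeSupport e (.inl ⟨a, 0, ha⟩) ∩ S := by
  ext w
  have := apply_notMem_edgeSupport (e := e) (ha := ha) hp
  grind [mem_symmDiff]

theorem symmDiff_mem_anchoredStrings_of_ne (hL : ∀ q, hubTerm e q ∈ L) (c : C) (hpa : p.1 ≠ a)
    (hqa : q.1 ≠ a) (hpq : p.1 ≠ q.1) (hS : S ∈ anchoredStrings e L ha) :
    S ∆ {e (.inl p)} ∆ {e (.inl q)} ∈ anchoredStrings e L ha := by
  refine ⟨?_, by
    rw [edgeSupport_inter_symmDiff_singleton hqa, edgeSupport_inter_symmDiff_singleton hpa]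
    exact hS.2⟩
  have H := isFrustrationFamily_hubTerm (e := e)
  let edge := hubTerm e (.inl ⟨a, 0, by lia⟩)
  let flip (p : Arm m) : Op W := Complex.I • xString {e (.inl p)}
  have hedge : edge = Complex.I • zString (edgeSupport e (.inl ⟨a, 0, ha⟩)) :=
    hubTerm_two_mul ⟨a, 0, ha⟩
  have hanti : Anticommute edge (Complex.I • xString S) := by
    rw [hedge]
    exact (xString_anticommute_zString hS.2).symm.smul_smul _ _
  have hflip_edge {p : Arm m} (hp : p.1 ≠ a) : Commute (flip p) edge := by
    simp only [flip, edge, ← hubTerm_two_mul_add_one]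
    exact H.commute (by simp [hp])
  have hflip_S (p : Arm m) : Commute (flip p) (Complex.I • xString S) :=
    ((xString_commute _ _).smul_left _).smul_right _
  have hmem : flip p * flip q * edge ∈ L := by
    simp only [flip, edge, ← hubTerm_two_mul_add_one]
    exact hubTerm_mul_hubTerm_mul_hubTerm_mem hL c hpa.symm hqa.symm hpq rfl _ _
  have hprod : flip p * flip q * (Complex.I • xString S) =
      -(Complex.I • xString (S ∆ {e (.inl p)} ∆ {e (.inl q)})) := by
    rw [smul_mul_smul_comm, smul_mul_smul_comm, xString_mul_xString, xString_mul_xString,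
      Complex.I_mul_I, neg_one_mul, neg_smul, symmDiff_comm, symmDiff_assoc]
  rw [← neg_mem_iff, ← hprod]
  exact hanti.mul_mem_of_mul_mem (H.mul_self _) ((hflip_edge hpa).mul_left (hflip_edge hqa))
    ((hflip_S p).mul_left (hflip_S q)) (hL _) hS.1 hmem

theorem symmDiff_mem_anchoredStrings (hL : ∀ q, hubTerm e q ∈ L) (c : C) (hJ : 3 ≤ ENat.card J)
    (hm : ∀ j, 0 < m j) (hpa : p.1 ≠ a) (hqa : q.1 ≠ a) (hS : S ∈ anchoredStrings e L ha) :
    S ∆ {e (.inl p)} ∆ {e (.inl q)} ∈ anchoredStrings e L ha := by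
  obtain hpq | hpq := eq_or_ne p.1 q.1
  swap
  · exact symmDiff_mem_anchoredStrings_of_ne hL c hpa hqa hpq hS
  obtain ⟨d, hda, hdp⟩ := ENat.exists_ne_ne_of_three_le hJ a p.1
  have := symmDiff_mem_anchoredStrings_of_ne hL c (p := ⟨d, 0, hm d⟩) hda hqa (hpq ▸ hdp) <|
    symmDiff_mem_anchoredStrings_of_ne hL c (q := ⟨d, 0, hm d⟩) hpa hda hdp.symm hS
  rwa [symmDiff_symmDiff_cancel_right] at this

/-- The qubit `q` absorbs the parity of the number of flips. -/
theorem exists_mem_anchoredStrings (hL : ∀ q, hubTerm e q ∈ L) (c : C) (hJ : 3 ≤ ENat.card J)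
    (hm : ∀ j, 0 < m j) (hqa : q.1 ≠ a) {E : Finset (Arm m)}
    (hE : ∀ p ∈ E, p.1 ≠ a ∧ p ≠ q) : ∃ S ∈ anchoredStrings e L ha,
      S.erase (e (.inl q)) =
        insert (e (.inl ⟨a, 0, ha⟩)) (E.map (.trans .inl e.toEmbedding)) := by
  classical
  induction E using Finset.induction_on with
  | empty =>
    refine ⟨_, singleton_mem_anchoredStrings hL, erase_eq_of_notMem ?_⟩
    simpa [Sigma.ext_iff] using fun h => absurd h hqa
  | insert p E hp ih =>
    obtain ⟨hpE, hE⟩ := forall_mem_insert _ _ _ |>.1 hE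
    obtain ⟨S, hS, hSE⟩ := ih hE
    refine ⟨_, symmDiff_mem_anchoredStrings hL c hJ hm hqa hpE.1 hS, ?_⟩
    have hpq : e (.inl p) ≠ e (.inl q) := by simpa using hpE.2
    have hpS : e (.inl p) ∉ S.erase (e (.inl q)) := by
      rw [hSE]
      simpa [hp] using fun h => hpE.1 (congrArg Sigma.fst h)
    rw [map_insert, insert_comm, ← hSE]
    ext w
    simp only [Function.Embedding.trans_apply, Function.Embedding.inl_apply, Equiv.coe_toEmbedding]
    grind [mem_symmDiff]

theorem two_pow_le_finrank (hL : ∀ q, hubTerm e q ∈ L) (c : C) [Fintype J] [DecidableEq J]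
    (hJ : 3 ≤ ENat.card J) (hm : ∀ j, 0 < m j) (a : J) :
    2 ^ (∑ j ∈ univ.erase a, m j - 1) ≤ Module.finrank ℝ L := by
  obtain ⟨b, hba, -⟩ := ENat.exists_ne_ne_of_three_le hJ a a
  let U : Finset (Arm m) := ((univ.erase a).sigma fun _ => univ).erase ⟨b, 0, hm b⟩
  have hcard : #U = ∑ j ∈ univ.erase a, m j - 1 := by
    rw [card_erase_of_mem (by simpa using hba), card_sigma]
    simp only [card_univ, Fintype.card_fin]
  have hU {p : Arm m} (hp : p ∈ U) : p.1 ≠ a ∧ p ≠ ⟨b, 0, hm b⟩ := by simpa [U, and_comm] using hp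
  choose S hS hSE using fun E : U.powerset =>
    exists_mem_anchoredStrings (ha := hm a) (q := ⟨b, 0, hm b⟩) hL c hJ hm hba
      fun p hp => hU (mem_powerset.1 E.2 hp)
  have hinj : Function.Injective S := fun E F hEF => by
    have hnotMem (E : U.powerset) : e (.inl ⟨a, 0, hm a⟩) ∉
        E.val.map (.trans .inl e.toEmbedding) := by
      simpa using fun h => (hU (mem_powerset.1 E.2 h)).1 rfl
    have hmap := congrArg (erase · (e (.inl ⟨a, 0, hm a⟩))) ((hSE E).symm.trans (hEF ▸ hSE F))
    simp only [erase_insert (hnotMem _)] at hmap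
    exact Subtype.ext (map_injective _ hmap)
  have hli : LinearIndependent ℝ fun E => (⟨Complex.I • xString (S E), (hS E).1⟩ : L) :=
    .of_comp L.toSubmodule.subtype (linearIndependent_I_smul_xString.comp S hinj)
  rw [← hcard, ← card_powerset, ← Fintype.card_coe]
  exact hli.fintype_card_le_finrank

theorem half_mul_sqrt_two_pow_le_finrank (hL : ∀ q, hubTerm e q ∈ L) (c : C) [Fintype J]
    (hJ : 3 ≤ ENat.card J) (hm : ∀ j, 0 < m j) :
    1 / 2 * √2 ^ (∑ j, m j) ≤ (Module.finrank ℝ L : ℝ) := by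
  classical
  have : Nonempty J := (ENat.one_le_card_iff_nonempty J).1 (le_trans (by norm_num) hJ)
  obtain ⟨a, ha⟩ := Finite.exists_min m
  obtain ⟨b, hba, -⟩ := ENat.exists_ne_ne_of_three_le hJ a a
  set N := ∑ j ∈ univ.erase a, m j
  have hbN : m b ≤ N := single_le_sum_of_canonicallyOrdered (mem_erase.2 ⟨hba, mem_univ b⟩)
  have hsum : ∑ j, m j ≤ 2 * N := by
    rw [← add_sum_erase _ _ (mem_univ a)]
    have := ha b
    lia
  have hN : N - 1 + 1 = N := Nat.sub_add_cancel ((hm b).trans_le hbN)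
  calc 1 / 2 * √2 ^ (∑ j, m j) ≤ 1 / 2 * √2 ^ (2 * N) := by
        gcongr
        exact Real.one_le_sqrt.2 one_le_two
    _ = 2 ^ (N - 1) := by
        rw [pow_mul, Real.sq_sqrt zero_le_two, ← hN, pow_succ']
        simp
    _ ≤ Module.finrank ℝ L := mod_cast two_pow_le_finrank hL c hJ hm a

end Growth

section Spider

open Finset

variable {k : ℕ} {m : Fin k → ℕ}

/-- A spider is a hub graph with a single hub, its centre. -/
def spiderIso (m : Fin k → ℕ) : hubGraph PUnit m ≃g spider m where
  toEquiv := (Equiv.optionEquivSumPUnit _).symm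
  map_rel_iff' {x y} := by
    obtain p | c := x <;> obtain q | c' := y <;>
      simp [spider, SpiderStep, hubGraph, HubStep, Sigma.ext_iff]

/-- Without its centre, a spider is a hub graph without hubs. -/
def reducedSpiderIso (m : Fin k → ℕ) :
    hubGraph Empty m ≃g reducedGraph (spider m) (spiderCentre m) where
  toFun := Sum.elim (fun p => ⟨some p, Option.some_ne_none p⟩) Empty.elim
  invFun w := .inl (w.val.get (Option.isSome_iff_ne_none.2 w.2))
  left_inv x := by
    obtain p | c := x
    · rfl
    · exact c.elim
  right_inv w := by simp
  map_rel_iff' {x y} := by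
    obtain p | c := x
    · obtain q | c' := y
      · simp [spider, SpiderStep, hubGraph, HubStep]
      · exact c'.elim
    · exact c.elim

theorem problem_spider (m : Fin k → ℕ) :
    problem (spider m) = ∑ p, zString (edgeSupport (spiderIso m).toEquiv (.inl p)) := by
  classical
  rw [problem, sum_pauliZZ_edgeFinset (spiderIso m),
    filter_true_of_mem fun p _ => exists_hubStep_of_nonempty p]

theorem spider_adj_centre_iff (p : Arm m) :
    (spider m).Adj (spiderCentre m) (reducedSpiderIso m (.inl p)).val ↔
      ¬∃ x, HubStep Empty m x (.inl p) := by
  rw [exists_hubStep_iff_of_isEmpty, not_not]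
  change (spider m).Adj none (some p) ↔ _
  simp [spider, SpiderStep]

theorem reducedProblem_spider (m : Fin k → ℕ) : reducedProblem (spider m) (spiderCentre m) =
    ∑ p, zString (edgeSupport (reducedSpiderIso m).toEquiv (.inl p)) := by
  classical
  rw [reducedProblem, sum_pauliZZ_edgeFinset (reducedSpiderIso m),
    ← sum_filter_add_sum_filter_not univ fun p => ∃ x, HubStep Empty m x (.inl p)]
  congr 1
  refine (sum_nbij (fun p => reducedSpiderIso m (.inl p)) (fun p hp => ?_) (fun _ _ _ _ h => ?_)
    (fun w hw => ?_) fun p hp => ?_).symm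
  · simpa only [mem_filter_univ, spider_adj_centre_iff] using hp
  · exact Sum.inl_injective ((reducedSpiderIso m).injective h)
  · obtain ⟨p | c, rfl⟩ := (reducedSpiderIso m).surjective w
    · have hadj := (mem_filter_univ _).1 (mem_coe.1 hw)
      exact ⟨p, mem_coe.2 ((mem_filter_univ p).2 ((spider_adj_centre_iff p).1 hadj)), rfl⟩
    · exact c.elim
  · exact zString_edgeSupport_of_not_hubStep _ ((mem_filter_univ p).1 hp)

theorem hubTerm_mem_stdDLA (hk : 3 ≤ k) (hm : ∀ j, 1 ≤ m j) (hinj : Function.Injective m)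
    (q : Arm (fun j => 2 * m j) ⊕ PUnit) :
    hubTerm (spiderIso m).toEquiv q ∈ stdDLA (spider m) := by
  refine hubTerm_mem (isRigid_hubColouring_of_unique ?_ ?_ ?_) ?_ ?_ q
  · exact fun i j hij => hinj (by lia)
  · exact fun j => by have := hm j; lia
  · simpa [Nat.lt_iff_add_one_le] using hk
  · exact LieSubalgebra.subset_lieSpan (by simp)
  · exact LieSubalgebra.subset_lieSpan (by simp [problem_spider])

theorem hubTerm_mem_reducedStdDLA (hinj : Function.Injective m)
    (q : Arm (fun j => 2 * m j) ⊕ Empty) : hubTerm (reducedSpiderIso m).toEquiv q ∈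
      reducedStdDLA (spider m) (spiderCentre m) := by
  refine hubTerm_mem (isRigid_hubColouring_of_isEmpty ?_ ?_) ?_ ?_ q
  · exact fun i j hij => hinj (by lia)
  · simp
  · exact LieSubalgebra.subset_lieSpan (by simp)
  · exact LieSubalgebra.subset_lieSpan (by simp [reducedProblem_spider])

theorem hubTerm_inl_mem_reducedFreeDLA (p : Arm fun j => 2 * m j) :
    hubTerm (reducedSpiderIso m).toEquiv (.inl p) ∈ reducedFreeDLA (spider m) (spiderCentre m) := by
  refine LieSubalgebra.subset_lieSpan ?_
  cases hcol : hubColouring Empty _ (.inl p)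
  · obtain ⟨i, hi⟩ := exists_qubit_eq_inl_of_colour_false hcol
    rw [hubTerm_of_colour_false hcol, hi]
    by_cases hstep : ∃ x, HubStep Empty m x (.inl i)
    · obtain ⟨x, hx⟩ := hstep
      rw [zString_edgeSupport_of_hubStep _ hx]
      exact .inl (.inr ⟨_, (reducedSpiderIso m).map_adj_iff.2 hx.adj, rfl⟩)
    · rw [zString_edgeSupport_of_not_hubStep _ hstep]
      exact .inr ⟨_, (spider_adj_centre_iff i).2 hstep, rfl⟩
  · rw [hubTerm_of_colour_true hcol, xString_singleton]
    exact .inl (.inl ⟨_, rfl⟩)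

theorem reducedFreeDLA_le {L : LieSubalgebra ℝ (Op (Rest (spiderCentre m)))}
    (hL : ∀ q, hubTerm (reducedSpiderIso m).toEquiv q ∈ L) :
    reducedFreeDLA (spider m) (spiderCentre m) ≤ L := by
  refine LieSubalgebra.lieSpan_le.2 ?_
  rintro _ ((⟨w, rfl⟩ | ⟨E, hE, rfl⟩) | ⟨w, hw, rfl⟩)
  · obtain ⟨x, rfl⟩ := (reducedSpiderIso m).surjective w
    obtain ⟨q, hq, rfl⟩ := exists_qubit_eq_of_colour_true x
    simpa [hubTerm_of_colour_true hq, xString_singleton] using hL q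
  · obtain ⟨x, p, hstep, rfl⟩ := exists_hubStep_of_mem_edgeSet (reducedSpiderIso m) hE
    obtain ⟨q, hq, hqp⟩ := exists_qubit_eq_of_colour_false (C := Empty) p
    have := hL q
    rw [hubTerm_of_colour_false hq, hqp, zString_edgeSupport_of_hubStep _ hstep] at this
    exact this
  · obtain ⟨p | c, rfl⟩ := (reducedSpiderIso m).surjective w
    · obtain ⟨q, hq, hqp⟩ := exists_qubit_eq_of_colour_false (C := Empty) p
      have := hL q
      rw [hubTerm_of_colour_false hq, hqp,
        zString_edgeSupport_of_not_hubStep _ ((spider_adj_centre_iff p).1 hw)] at this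
      exact this
    · exact c.elim

theorem reducedStdDLA_spider (hinj : Function.Injective m) :
    reducedStdDLA (spider m) (spiderCentre m) = reducedFreeDLA (spider m) (spiderCentre m) := by
  refine le_antisymm (LieSubalgebra.lieSpan_le.2 ?_)
    (reducedFreeDLA_le (hubTerm_mem_reducedStdDLA hinj))
  have hterm (q) : hubTerm (reducedSpiderIso m).toEquiv q ∈
      reducedFreeDLA (spider m) (spiderCentre m) :=
    Sum.casesOn q hubTerm_inl_mem_reducedFreeDLA Empty.rec
  rintro _ (rfl | rfl)
  · rw [← sum_hubTerm_colour_true (reducedSpiderIso m).toEquiv]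
    exact sum_mem fun q _ => hterm q
  · rw [reducedProblem_spider, ← sum_hubTerm_colour_false]
    exact sum_mem fun q _ => hterm q

theorem reducedFreeDLA_spider (m : Fin k → ℕ) : reducedFreeDLA (spider m) (spiderCentre m) =
    LieSubalgebra.lieSpan ℝ _
      (Set.range fun p => hubTerm (reducedSpiderIso m).toEquiv (.inl p)) := by
  refine le_antisymm (reducedFreeDLA_le ?_) (LieSubalgebra.lieSpan_le.2 ?_)
  · rintro (p | c)
    · exact LieSubalgebra.subset_lieSpan ⟨p, rfl⟩
    · exact c.elim
  · exact Set.range_subset_iff.2 hubTerm_inl_mem_reducedFreeDLA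

/-- The free reduced DLA of a spider as the image of the spin representation of its arms. -/
def directSumSoEquivReducedFreeDLA (m : Fin k → ℕ) :
    (⨁ j, LieAlgebra.Orthogonal.so (Fin (2 * m j + 1)) ℝ) ≃ₗ⁅ℝ⁆
      reducedFreeDLA (spider m) (spiderCentre m) :=
  (directSumSoEquiv (reducedSpiderIso m).toEquiv).trans <|
    LieEquiv.ofEq _ _ <| congrArg _ (reducedFreeDLA_spider m).symm

theorem finrank_reducedFreeDLA_spider (m : Fin k → ℕ) :
    Module.finrank ℝ (reducedFreeDLA (spider m) (spiderCentre m)) =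
      2 * ∑ j, m j ^ 2 + ∑ j, m j := by
  rw [← (directSumSoEquivReducedFreeDLA m).toLinearEquiv.finrank_eq, finrank_directSum_so]

end Spider

end QAOA

end

theorem mainTheorem6 :
    (∀ (k : ℕ) (m : Fin k → ℕ), (∀ j, 1 ≤ m j) → Function.Injective m →
      QAOA.reducedStdDLA (QAOA.spider m) (QAOA.spiderCentre m) =
          QAOA.reducedFreeDLA (QAOA.spider m) (QAOA.spiderCentre m) ∧
        Nonempty (QAOA.reducedStdDLA (QAOA.spider m) (QAOA.spiderCentre m) ≃ₗ⁅ℝ⁆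
          (⨁ j : Fin k, LieAlgebra.Orthogonal.so (Fin (2 * m j + 1)) ℝ)) ∧
        Module.finrank ℝ (QAOA.reducedStdDLA (QAOA.spider m) (QAOA.spiderCentre m)) =
          2 * ∑ j, m j ^ 2 + ∑ j, m j ∧
        2 * ∑ j, m j ^ 2 + ∑ j, m j ≤ 2 * (∑ j, m j) ^ 2 + ∑ j, m j) ∧
    (∃ c a : ℝ, 0 < c ∧ 1 < a ∧
      ∀ (k : ℕ) (m : Fin k → ℕ), 3 ≤ k → (∀ j, 1 ≤ m j) → Function.Injective m →
        c * a ^ (∑ j, m j) ≤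
          (Module.finrank ℝ (QAOA.stdDLA (QAOA.spider m)) : ℝ)) := by
  refine ⟨fun k m _ hinj => ?_, 1 / 2, √2, by norm_num, Real.one_lt_sqrt_two,
    fun k m hk hm hinj => QAOA.half_mul_sqrt_two_pow_le_finrank
      (QAOA.hubTerm_mem_stdDLA hk hm hinj) PUnit.unit (by simpa) hm⟩
  rw [QAOA.reducedStdDLA_spider hinj]
  refine ⟨rfl, ⟨(QAOA.directSumSoEquivReducedFreeDLA m).symm⟩,
    QAOA.finrank_reducedFreeDLA_spider m, ?_⟩
  gcongr
  exact Finset.sum_sq_le_sq_sum_of_nonneg fun j _ => zero_le
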